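/- Automata are deterministic and finite (finite alphabet \(\Sigma\), finite state set, an initial state, a set of accepting states), with a transition function that may be partial. An automaton is reduced if every state is reachable from the initial state and distinct states \(p\ne q\) are inequivalent, i.e. the sets of words leading from \(p\), respectively from \(q\), to an accepting state differ. For an integer \(k\ge 1\), an automaton accepting the language \(L\) is \(k\)-testable if any two nonempty words \(u,v\) over \(\Sigma\) which have the same prefix of length \(k-1\), the same suffix of length \(k-1\) (the whole word, if it is shorter than \(k-1\)) and the same set of factors of length \(k\) satisfy \(u\in L\iff v\in L\). It is locally testable if it is \(k\)-testable for some \(k\ge 1\); the least such \(k\) is its order of local testability. Theorem. Let \(n\ge 1\). The maximum of the orders of local testability of the locally testable reduced deterministic finite automata with exactly \(n\) states is \(\frac{n^2-n}{2}+1\): every such automaton has order at most \(\frac{n^2-n}{2}+1\), and some such automaton has exactly this order. Moreover: (a) For \(n>2\) the bound is attained by the following automaton \(\mathbf M\). Its states are \(q_1,\dots,q_n\), and its alphabet consists of a letter \(a\) and letters \(b_{i,j}\) for \(1\le i\le n-2\), \(i<j\le n\). The transitions are \(q_3a=q_1\); \(q_ib_{i,j}=q_i\) and \(q_jb_{i,j}=q_{j+1}\)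 for \(i<j<n\); \(q_ib_{i,n}=q_{i+1}\) and \(q_nb_{i,n}=q_{i+2}\); all other transitions are undefined. For every choice of the initial state and every nonempty set of accepting states, \(\mathbf M\) is reduced and locally testable, and its order of local testability is \(\frac{n^2-n}{2}+1\). (b) For \(n=2\) the bound is attained by an automaton whose transition semigroup (the partial maps of the state set induced by nonempty words) is a semigroup of left zeros, i.e. satisfies \(xy=x\). -/

import Mathlib

universe u v

namespace LocalTestability

/-- `u` and `v` have the same prefix of length `k - 1`, the same suffix of length `k - 1` (the whole
word, if the word is shorter than `k - 1`) and the same set of factors of length `k`. -/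
def SameLocalData {α : Type*} (k : ℕ) (u v : List α) : Prop :=
  u.take (k - 1) = v.take (k - 1) ∧
  u.rtake (k - 1) = v.rtake (k - 1) ∧
  {f : List α | f <:+: u ∧ f.length = k} = {f : List α | f <:+: v ∧ f.length = k}

/-- The language `L` is `k`-testable (`k` a positive integer): membership of a nonempty word is
determined by its prefix and suffix of length `k - 1` and its set of factors of length `k`. -/
def IsKTestable {α : Type*} (L : Language α) (k : ℕ) : Prop :=
  1 ≤ k ∧ ∀ u v : List α, u ≠ [] → v ≠ [] → SameLocalData k u v → (u ∈ L ↔ v ∈ L)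

/-- A deterministic automaton with alphabet `α` and set of states `σ`, whose transition function may
be partial (`none` means that the transition is undefined). -/
structure PartialDFA (α : Type*) (σ : Type*) where
  step : σ → α → Option σ
  start : σ
  accept : Set σ

namespace PartialDFA

variable {α : Type*} {σ : Type*}

/-- The state reached from `p` by reading the word, if it exists. -/
def run (A : PartialDFA α σ) : σ → List α → Option σ
  | p, [] => some p
  | p, a :: w => (A.step p a).bind (fun q => A.run q w)

/-- The language of the words that lead from the state `p` to an accepting state. -/
def acceptsFrom (A : PartialDFA α σ) (p : σ) : Language α :=
  {w | ∃ q ∈ A.accept, A.run p w = some q}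

/-- The language accepted by the automaton. -/
def accepts (A : PartialDFA α σ) : Language α := A.acceptsFrom A.start

/-- The automaton is reduced: every state is reachable from the initial state, and no two distinct
states are equivalent. -/
def IsReduced (A : PartialDFA α σ) : Prop :=
  (∀ p, ∃ w, A.run A.start w = some p) ∧
  ∀ p q, A.acceptsFrom p = A.acceptsFrom q → p = q

/-- The automaton is locally testable: its language is `k`-testable for some positive `k`. -/
def IsLocallyTestable (A : PartialDFA α σ) : Prop :=
  ∃ k, IsKTestable A.accepts k

/-- The order of local testability of a locally testable automaton: the least positive `k` such that
its language is `k`-testable. -/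
noncomputable def order (A : PartialDFA α σ) : ℕ :=
  sInf {k | IsKTestable A.accepts k}

/-- The transition semigroup (the partial maps induced by the nonempty words) is a semigroup of left
zeros: it satisfies the identity `xy = x`. -/
def HasLeftZeroTransitionSemigroup (A : PartialDFA α σ) : Prop :=
  ∀ x y : List α, x ≠ [] → y ≠ [] → ∀ p, A.run p (x ++ y) = A.run p x

end PartialDFA

/-- The alphabet of the automaton `M`: the letter `a`, which is `none`, and the letters `b i j`,
where `i < j` and `i` is neither the last state nor the last but one. States are numbered from `0`,
so `i : Fin n` stands for the state `q_{i+1}`. -/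
abbrev MLetter (n : ℕ) : Type :=
  Option {p : Fin n × Fin n // p.1 < p.2 ∧ p.1.val + 2 < n}

/-- The transitions of `M`, with states numbered from `0`. The letter `a` maps `2` to `0`. If `j` is
not the last state, `b i j` fixes `i` and maps `j` to `j + 1`; if `j` is the last state, `b i j` maps
`i` to `i + 1` and `j` to `i + 2`. All other transitions are undefined. -/
def mStep {n : ℕ} (p : Fin n) : MLetter n → Option (Fin n)
  | none => if p.val = 2 then some ⟨0, p.pos⟩ else none
  | some ⟨(i, j), h⟩ =>
    if hj : j.val + 1 < n then
      if p = i then some i else if p = j then some ⟨j.val + 1, hj⟩ else none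
    else
      if p = i then some ⟨i.val + 1, by have := h.2; simp only at this; omega⟩
      else if p = j then some ⟨i.val + 2, h.2⟩ else none

/-- The automaton `M` with `n` states, with initial state `s` and set of accepting states `F`. -/
def mAutomaton {n : ℕ} (s : Fin n) (F : Set (Fin n)) : PartialDFA (MLetter n) (Fin n) where
  step := mStep
  start := s
  accept := F

end LocalTestability

/-! Put N = n(n-1)/2, the number of unordered pairs of distinct states.

Upper bound. A word of length at least N is a path in the de Bruijn graph whose vertices are the
words of length N and whose edges are the words of length N + 1. Its local data of order N + 1 are
the endpoints and the edge set of this path. By Simon's theorem (`LoopLaws.foldl_eq_of_mem_iff`)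
coterminal paths with the same edges act alike as soon as loops act as commuting idempotents. So it
suffices that, after reading a word w of length N, the words x for which w x ends in w act in this
way (`loop_idem`, `loop_comm`).

Local testability of some unknown order K gives such laws only behind words e of length at least K
(`TestableAction`). Pigeonhole bridges the gap: two states that survive w and stay distinct form N +
1 pairs along the way, so a pair recurs, and some nonempty factor b of w fixes both of its states.
Powers of b are arbitrarily long, so the laws of order K apply at these states. In particular, two
states of one strongly connected component fixed by the same nonempty word coincide (`eq_of_fixed`).
Idempotence needs a sharper count, over pairs of states one period apart (`periodic_idem`).

Lower bound. In `M` the ordered pairs of states climb strictly in the lexicographic order, so N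
letters merge or kill every pair, and order N + 1 suffices. A word of length N - 1 leads the first
pair through all pairs to the last one, and behind it idempotence fails. -/

namespace LocalTestability

/-! ### Simon's theorem on paths in a graph -/

section PathActions

variable {V E Ω : Type*} (src tgt : E → V)

/-- `x` is a path from `s` to `t` in the directed graph with edge set `E`. -/
def IsPath : V → List E → V → Prop
  | s, [], t => s = t
  | s, e :: x, t => src e = s ∧ IsPath (tgt e) x t

variable {src tgt}

theorem isPath_append {s t : V} {x y : List E} :
    IsPath src tgt s (x ++ y) t ↔ ∃ v, IsPath src tgt s x v ∧ IsPath src tgt v y t := by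
  induction x generalizing s with
  | nil => simp [IsPath]
  | cons e x ih => simp only [List.cons_append, IsPath, ih]; tauto

theorem IsPath.append {s v t : V} {x y : List E} (hx : IsPath src tgt s x v)
    (hy : IsPath src tgt v y t) : IsPath src tgt s (x ++ y) t :=
  isPath_append.2 ⟨v, hx, hy⟩

theorem IsPath.target_unique {s t t' : V} {x : List E} (h : IsPath src tgt s x t)
    (h' : IsPath src tgt s x t') : t = t' := by
  induction x generalizing s with
  | nil => exact h.symm.trans h'
  | cons e x ih => exact ih h.2 h'.2

/-- A transformation of the states along the edges, in which a state may sit at a vertex, and in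
which the loops at a vertex act as commuting idempotents. -/
structure LoopLaws (src tgt : E → V) (δ : Ω → E → Ω) (At : V → Ω → Prop) : Prop where
  step : ∀ e p, At (src e) p → At (tgt e) (δ p e)
  comm : ∀ v p x y, At v p → IsPath src tgt v x v → IsPath src tgt v y v →
    (x ++ y).foldl δ p = (y ++ x).foldl δ p
  idem : ∀ v p x, At v p → IsPath src tgt v x v → (x ++ x).foldl δ p = x.foldl δ p

namespace LoopLaws

variable {δ : Ω → E → Ω} {At : V → Ω → Prop} (H : LoopLaws src tgt δ At)
include H

theorem at_foldl {s t : V} {p : Ω} {x : List E} (hp : At s p) (hx : IsPath src tgt s x t) :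
    At t (x.foldl δ p) := by
  induction x generalizing s p with
  | nil => cases hx; exact hp
  | cons e x ih =>
    obtain ⟨h, hx⟩ := hx
    subst h
    exact ih (H.step e p hp) hx

/-- Each edge `f` of `z` can be undone: an earlier occurrence of `f` is followed by a path `y2` back
to the source of `f`, and the loop `f y2`, just completed, may be repeated by idempotence. -/
theorem exists_return {s v u : V} {p : Ω} {y z : List E} (hp : At s p)
    (hy : IsPath src tgt s y v) (hz : IsPath src tgt v z u) (hzy : z ⊆ y) :
    ∃ r, IsPath src tgt u r v ∧ r ⊆ y ∧ (y ++ z ++ r).foldl δ p = y.foldl δ p := by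
  induction z using List.reverseRecOn generalizing u with
  | nil => cases hz; exact ⟨[], rfl, by simp, by simp⟩
  | append_singleton z f ih =>
    obtain ⟨u', hz', hf⟩ := isPath_append.1 hz
    obtain ⟨hf1, hf2⟩ := hf
    subst hf1
    cases hf2
    have hzy' : z ⊆ y := fun a ha => hzy (by simp [ha])
    obtain ⟨r, hr, hry, he⟩ := ih hz' hzy'
    have hfy : f ∈ y ++ z := by
      have := hzy (a := f) (by simp)
      simp [this]
    obtain ⟨y1, y2, h12⟩ := List.append_of_mem hfy
    have hyz := hy.append hz'
    rw [h12] at hyz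
    obtain ⟨v1, hy1, hf1, hy2⟩ := isPath_append.1 hyz
    subst hf1
    refine ⟨y2 ++ r, hy2.append hr, ?_, ?_⟩
    · intro a ha
      rcases List.mem_append.1 ha with ha | ha
      · have : a ∈ y ++ z := by rw [h12]; simp [ha]
        rcases List.mem_append.1 this with h | h
        exacts [h, hzy' h]
      · exact hry ha
    · have hid := H.idem _ _ (f :: y2) (H.at_foldl hp hy1) ⟨rfl, hy2⟩
      have e1 : (y ++ z ++ (f :: y2)).foldl δ p = (y ++ z).foldl δ p := by
        rw [h12, List.append_assoc, List.foldl_append, hid, ← List.foldl_append]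
      calc (y ++ (z ++ [f]) ++ (y2 ++ r)).foldl δ p
          = (y ++ z ++ (f :: y2) ++ r).foldl δ p := by simp
        _ = (y ++ z ++ r).foldl δ p := by rw [List.foldl_append, e1, ← List.foldl_append]
        _ = _ := he

/-- A loop whose edges have all been traversed before acts trivially. -/
theorem foldl_append_loop {s v : V} {p : Ω} {y z : List E} (hp : At s p)
    (hy : IsPath src tgt s y v) (hz : IsPath src tgt v z v) (hzy : z ⊆ y) :
    (y ++ z).foldl δ p = y.foldl δ p := by
  obtain ⟨r, hr, -, he⟩ := H.exists_return hp hy hz hzy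
  -- With q the state after `y`, `z r` fixes q. Commuting idempotent loops give q z r z = q z z r =
  -- q z r, that is, q z = q.
  have hq := H.at_foldl hp hy
  have h1 := H.comm v _ z r hq hz hr
  have h2 := H.idem v _ z hq hz
  have h3 := H.comm v _ r z (H.at_foldl hq hz) hr hz
  simp only [List.foldl_append] at *
  rw [h2, he] at h3
  exact h3

/-- If one can return from the target of the edge `e` to its source along edges of a path through
`e`, then the path acts as one that does so. -/
theorem exists_through_twice {s t : V} {p : Ω} {P Q ρ : List E} {e : E} (hp : At s p)
    (hx : IsPath src tgt s (P ++ e :: Q) t) (hρ : IsPath src tgt (tgt e) ρ (src e))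
    (hρx : ρ ⊆ P ++ e :: Q) :
    ∃ R S, IsPath src tgt (tgt e) R (src e) ∧ IsPath src tgt (src e) S t ∧
      (∀ a, a ∈ P ++ e :: Q ↔ a ∈ P ++ e :: (R ++ S)) ∧
      (P ++ e :: (R ++ S)).foldl δ p = (P ++ e :: Q).foldl δ p := by
  obtain ⟨v1, hP, hv1, hQ⟩ := isPath_append.1 hx
  subst hv1
  have hQρ : ∀ f ∈ P ++ e :: Q, f ∉ P ++ [e] → f ∈ Q := by
    intro f hf hf'
    simp only [List.mem_append, List.mem_cons, List.not_mem_nil, or_false, not_or] at hf hf'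
    tauto
  -- The return can be chosen to follow `Q` for a while and then to use edges of `P ++ [e]` only: an
  -- edge of the return outside `P ++ [e]` lies on `Q`, so `Q` can be followed through it, which
  -- leaves a shorter return.
  have key : ∀ (n : ℕ) (ρ : List E) (u : V), ρ.length ≤ n → IsPath src tgt u ρ (src e) →
      ρ ⊆ P ++ e :: Q → (∃ Q1 Q2, Q = Q1 ++ Q2 ∧ IsPath src tgt (tgt e) Q1 u) →
      ∃ ρ2 Q1 Q2 u', Q = Q1 ++ Q2 ∧ IsPath src tgt (tgt e) Q1 u' ∧
        IsPath src tgt u' ρ2 (src e) ∧ ρ2 ⊆ P ++ [e] := by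
    intro n
    induction n with
    | zero =>
      rintro ρ u hn hu - ⟨Q1, Q2, h, h'⟩
      obtain rfl : ρ = [] := List.length_eq_zero_iff.1 (by omega)
      exact ⟨[], Q1, Q2, u, h, h', hu, by simp⟩
    | succ n ih =>
      rintro ρ u hn hu hsub ⟨Q1, Q2, h, h'⟩
      by_cases hall : ρ ⊆ P ++ [e]
      · exact ⟨ρ, Q1, Q2, u, h, h', hu, hall⟩
      · obtain ⟨f, hf, hf'⟩ : ∃ f ∈ ρ, f ∉ P ++ [e] := by
          by_contra hcon
          push Not at hcon
          exact hall hcon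
        have hfQ := hQρ f (hsub hf) hf'
        obtain ⟨ρa, ρb, rfl⟩ := List.append_of_mem hf
        obtain ⟨Qa, Qb, hQab⟩ := List.append_of_mem hfQ
        obtain ⟨w, -, -, hρb⟩ := isPath_append.1 hu
        refine ih ρb (tgt f) (by simp at hn; omega) hρb (fun a ha => hsub (by simp [ha])) ?_
        refine ⟨Qa ++ [f], Qb, by simp [hQab], ?_⟩
        rw [hQab] at hQ
        obtain ⟨w', hQa, hf1, -⟩ := isPath_append.1 hQ
        exact hQa.append ⟨hf1, rfl⟩
  obtain ⟨ρ2, Q1, Q2, u', rfl, hQ1, hρ2, hsub⟩ :=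
    key ρ.length ρ (tgt e) le_rfl hρ hρx ⟨[], Q, rfl, rfl⟩
  obtain ⟨u'', hQ1', hQ2⟩ := isPath_append.1 hQ
  obtain rfl := hQ1'.target_unique hQ1
  refine ⟨Q1 ++ ρ2, e :: (Q1 ++ Q2), hQ1.append hρ2, ⟨rfl, hQ1.append hQ2⟩, ?_, ?_⟩
  · intro a
    have := @hsub a
    simp only [List.mem_append, List.mem_cons, List.not_mem_nil, or_false] at *
    tauto
  -- The loop `ρ2 e Q1` uses old edges only, so inserting it, and with it a second passage through
  -- `e`, changes nothing.
  · have hloop := H.foldl_append_loop (y := P ++ e :: Q1) (z := ρ2 ++ e :: Q1) hp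
      (hP.append ⟨rfl, hQ1⟩) (hρ2.append ⟨rfl, hQ1⟩) (by
        intro a ha
        have := @hsub a
        simp only [List.mem_append, List.mem_cons, List.not_mem_nil, or_false] at *
        tauto)
    calc (P ++ e :: (Q1 ++ ρ2 ++ e :: (Q1 ++ Q2))).foldl δ p
        = (P ++ e :: Q1 ++ (ρ2 ++ e :: Q1) ++ Q2).foldl δ p := by simp
      _ = (P ++ e :: Q1 ++ Q2).foldl δ p := by
        rw [List.foldl_append, hloop, ← List.foldl_append]
      _ = _ := by simp

/-- Extend by an edge a prefix shared with another path. -/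
theorem exists_extend {s v t : V} {p : Ω} {y z y' : List E} {e : E} (hp : At s p)
    (hy : IsPath src tgt s y v) (hz : IsPath src tgt v z t)
    (hey' : IsPath src tgt v (e :: y') t) (hmem : ∀ a, a ∈ y ++ z ↔ a ∈ y ++ e :: y') :
    ∃ z', IsPath src tgt (tgt e) z' t ∧ (∀ a, a ∈ y ++ e :: z' ↔ a ∈ y ++ z) ∧
      (y ++ e :: z').foldl δ p = (y ++ z).foldl δ p := by
  obtain ⟨rfl, hy'⟩ := hey'
  -- If `e` occurs in `y`, it begins a loop `e y2` at the end of `y`, which may be repeated.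
  by_cases hey : e ∈ y
  · obtain ⟨y1, y2, rfl⟩ := List.append_of_mem hey
    obtain ⟨v1, hy1, hv1, hy2⟩ := isPath_append.1 hy
    subst hv1
    refine ⟨y2 ++ z, hy2.append hz, ?_, ?_⟩
    · intro a
      simp only [List.mem_append, List.mem_cons]
      tauto
    · have hid := H.idem _ _ (e :: y2) (H.at_foldl hp hy1) ⟨rfl, hy2⟩
      calc (y1 ++ e :: y2 ++ e :: (y2 ++ z)).foldl δ p
          = (y1 ++ (e :: y2 ++ e :: y2) ++ z).foldl δ p := by simp
        _ = (y1 ++ e :: y2 ++ z).foldl δ p := by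
          rw [List.foldl_append, List.foldl_append, hid, ← List.foldl_append, ← List.foldl_append,
            List.append_assoc]
  · have hez : e ∈ z := by
      have := (hmem e).2 (by simp)
      rcases List.mem_append.1 this with h | h
      exacts [absurd h hey, h]
    obtain ⟨z1, z2, rfl⟩ := List.append_of_mem hez
    obtain ⟨v1, hz1, hv1, hz2⟩ := isPath_append.1 hz
    subst hv1
    -- If a return exists, `z` may be replaced by `z1 e R S`, where `z1` and `e R` are loops at the
    -- same vertex. Commuting them brings `e` to the front.
    by_cases hret : ∃ ρ, IsPath src tgt (tgt e) ρ (src e) ∧ ρ ⊆ y ++ z1 ++ e :: z2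
    · obtain ⟨ρ, hρ, hsub⟩ := hret
      obtain ⟨R, S, hR, hS, hRS, heq⟩ := H.exists_through_twice hp
        ((hy.append hz1).append (y := e :: z2) ⟨rfl, hz2⟩) hρ hsub
      have hc := H.comm _ _ z1 (e :: R) (H.at_foldl hp hy) hz1 ⟨rfl, hR⟩
      refine ⟨R ++ z1 ++ S, (hR.append hz1).append hS, ?_, ?_⟩
      · intro a
        have := hRS a
        simp only [List.mem_append, List.mem_cons] at this ⊢
        grind
      · calc (y ++ e :: (R ++ z1 ++ S)).foldl δ p
            = (y ++ (e :: R ++ z1) ++ S).foldl δ p := by simp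
          _ = (y ++ (z1 ++ e :: R) ++ S).foldl δ p := by
            rw [List.foldl_append, List.foldl_append, ← hc, ← List.foldl_append,
              ← List.foldl_append, List.append_assoc y]
          _ = (y ++ z1 ++ e :: (R ++ S)).foldl δ p := by simp
          _ = _ := by rw [heq, List.append_assoc]
    -- Without a return, the loop `z1` has no new edge and can be dropped: a new edge would lie on
    -- `e y'`, hence be reached from the target of `e`, and the rest of `z1` would complete a
    -- return.
    · have hz1y : z1 ⊆ y := by
        intro f hf
        by_contra hfy
        obtain ⟨za, zb, rfl⟩ := List.append_of_mem hf
        obtain ⟨v2, -, hv2, hzb⟩ := isPath_append.1 hz1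
        have hfm := (hmem f).1 (by simp)
        have hfe : f = e ∨ f ∈ y' := by
          rcases List.mem_append.1 hfm with h | h
          · exact absurd h hfy
          · exact List.mem_cons.1 h
        rcases hfe with rfl | hfy'
        · exact hret ⟨zb, hzb, fun a ha => by simp [ha]⟩
        · obtain ⟨ya, yb, rfl⟩ := List.append_of_mem hfy'
          obtain ⟨v3, hya, hv3, -⟩ := isPath_append.1 hy'
          refine hret ⟨ya ++ f :: zb, hya.append ⟨hv3, hzb⟩, fun a ha => ?_⟩
          rcases List.mem_append.1 ha with h | h
          · have := (hmem a).2 (by simp [h])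
            simpa using this
          · rcases List.mem_cons.1 h with rfl | h <;> simp_all
      refine ⟨z2, hz2, ?_, ?_⟩
      · intro a
        have := @hz1y a
        simp only [List.mem_append, List.mem_cons] at this ⊢
        grind
      · have hl := H.foldl_append_loop hp hy hz1 hz1y
        rw [← List.append_assoc, List.foldl_append, List.foldl_append (l := y ++ z1), hl]

/-- **Simon's theorem**: coterminal paths with the same edges act in the same way. -/
theorem foldl_eq_of_mem_iff {s t : V} {p : Ω} {x y : List E} (hp : At s p)
    (hx : IsPath src tgt s x t) (hy : IsPath src tgt s y t) (hmem : ∀ a, a ∈ x ↔ a ∈ y) :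
    x.foldl δ p = y.foldl δ p := by
  -- The other path is rewritten edge by edge so that it shares an ever longer prefix `y1` with `y`.
  have key : ∀ (y2 y1 z : List E) (v : V), IsPath src tgt s y1 v → IsPath src tgt v y2 t →
      IsPath src tgt v z t → (∀ a, a ∈ y1 ++ z ↔ a ∈ y1 ++ y2) →
      (y1 ++ z).foldl δ p = (y1 ++ y2).foldl δ p := by
    intro y2
    induction y2 with
    | nil =>
      intro y1 z v h1 h2 h3 h4
      cases h2
      rw [H.foldl_append_loop hp h1 h3, List.append_nil]
      intro a ha
      simpa using (h4 a).1 (by simp [ha])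
    | cons e y2 ih =>
      intro y1 z v h1 h2 h3 h4
      obtain ⟨z', hz', hm, heq⟩ := H.exists_extend hp h1 h3 h2 h4
      rw [← heq]
      obtain ⟨rfl, h2⟩ := h2
      have := ih (y1 ++ [e]) z' (tgt e) (h1.append ⟨rfl, rfl⟩) h2 hz' (by
        intro a
        have h := (hm a).trans (h4 a)
        simpa using h)
      simpa using this
  exact key y [] x s rfl hy hx hmem

end LoopLaws
end PathActions

/-! ### Words as paths in the de Bruijn graph -/

section Words

variable {α Ω : Type*}

/-- The path from the word `w` in the de Bruijn graph that reads the word `x`. -/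
def wordEdges : List α → List α → List (List α × α)
  | _, [] => []
  | w, a :: x => (w, a) :: wordEdges (w ++ [a]).tail x

/-- The target of an edge of the de Bruijn graph. -/
def edgeTarget (e : List α × α) : List α := (e.1 ++ [e.2]).tail

theorem isPath_wordEdges (w x : List α) :
    IsPath Prod.fst edgeTarget w (wordEdges w x) ((w ++ x).drop x.length) := by
  induction x generalizing w with
  | nil => simp [wordEdges, IsPath]
  | cons a x ih =>
    refine ⟨rfl, ?_⟩
    have h : (w ++ a :: x).drop (a :: x).length = ((w ++ [a]).tail ++ x).drop x.length := by
      cases w <;> simp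
    rw [h]
    exact ih (w ++ [a]).tail

theorem IsPath.eq_wordEdges {w t : List α} {y : List (List α × α)}
    (h : IsPath Prod.fst edgeTarget w y t) : y = wordEdges w (y.map Prod.snd) := by
  induction y generalizing w with
  | nil => rfl
  | cons e y ih =>
    obtain ⟨rfl, h⟩ := h
    rw [List.map_cons, wordEdges, ← edgeTarget, ← ih h]

theorem foldl_wordEdges (δ : Ω → α → Ω) (p : Ω) (w x : List α) :
    (wordEdges w x).foldl (fun p e => δ p e.2) p = x.foldl δ p := by
  induction x generalizing w p with
  | nil => rfl
  | cons a x ih => simp [wordEdges, ih]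

theorem length_of_mem_wordEdges {f w x : List α} {a : α} (h : (f, a) ∈ wordEdges w x) :
    f.length = w.length := by
  induction x generalizing w with
  | nil => simp [wordEdges] at h
  | cons b x ih =>
    rcases List.mem_cons.1 h with h | h
    · cases h; rfl
    · simpa using ih h

theorem mem_wordEdges {f w x : List α} {a : α} (hf : f.length = w.length) :
    (f, a) ∈ wordEdges w x ↔ f ++ [a] <:+: w ++ x := by
  induction x generalizing w with
  | nil =>
    simp only [wordEdges, List.not_mem_nil, List.append_nil, false_iff]
    intro h
    have := h.length_le
    simp at this
    omega
  | cons b x ih =>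
    rw [wordEdges, List.mem_cons, ih (by simpa using hf)]
    cases w with
    | nil =>
      obtain rfl : f = [] := by simpa using hf
      simp [List.infix_cons_iff, List.prefix_cons_iff]
    | cons c w =>
      obtain ⟨d, f, rfl⟩ : ∃ d f', f = d :: f' := by
        cases f with
        | nil => simp at hf
        | cons d f => exact ⟨d, f, rfl⟩
      have h1 : (c :: w ++ [b]).tail ++ x = w ++ b :: x := by simp
      have h2 : c :: w ++ b :: x = c :: (w ++ b :: x) := rfl
      rw [h1, h2, List.infix_cons_iff]
      refine or_congr_left ?_
      have h3 : c :: (w ++ b :: x) = (c :: w ++ [b]) ++ x := by simp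
      rw [h3]
      constructor
      · intro h
        cases h
        exact List.prefix_append _ _
      · intro h
        have := List.prefix_of_prefix_length_le h (List.prefix_append _ x) (by
          simp at hf ⊢; omega)
        have := this.eq_of_length (by simp at hf ⊢; omega)
        obtain ⟨h4, h5⟩ := List.append_inj' this rfl
        obtain rfl : a = b := by simpa using h5
        rw [h4]

/-- If the words of length `m` satisfy the laws below, then words with the same local data act in
the same way. -/
theorem foldl_eq_of_sameLocalData (δ : Ω → α → Ω) (m : ℕ)
    (comm : ∀ o w x y, w.length = m → w <:+ w ++ x → w <:+ w ++ y →
      (w ++ x ++ y).foldl δ o = (w ++ y ++ x).foldl δ o)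
    (idem : ∀ o w x, w.length = m → w <:+ w ++ x →
      (w ++ x ++ x).foldl δ o = (w ++ x).foldl δ o)
    {u v : List α} (huv : SameLocalData (m + 1) u v) (o : Ω) : u.foldl δ o = v.foldl δ o := by
  obtain ⟨hpre, hsuf, hfac⟩ := huv
  simp only [Nat.add_sub_cancel] at hpre hsuf
  have hlen : min m u.length = min m v.length := by
    simpa using congrArg List.length hpre
  by_cases hu : u.length < m
  · have h1 : u.take m = u := List.take_of_length_le hu.le
    have h2 : v.take m = v := List.take_of_length_le (by omega)
    rw [← h1, ← h2, hpre]
  have hv : m ≤ v.length := by omega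
  have hu : m ≤ u.length := by omega
  set w := u.take m with hw
  have hwm : w.length = m := by simp [hw, hu]
  obtain ⟨x, hx⟩ : ∃ x, u = w ++ x := ⟨u.drop m, (List.take_append_drop m u).symm⟩
  obtain ⟨y, hy⟩ : ∃ y, v = w ++ y := ⟨v.drop m, by rw [hpre, List.take_append_drop]⟩
  have hloop : ∀ {w x : List α}, IsPath Prod.fst edgeTarget w (wordEdges w x) w → w <:+ w ++ x := by
    intro w x h
    have h' := h.target_unique (isPath_wordEdges w x)
    have h'' := List.drop_suffix x.length (w ++ x)
    rwa [← h'] at h''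
  -- A state sits at the vertex `w` if it can be reached by reading `w`; this is what restricts the
  -- loop laws to states behind `w`.
  have H : LoopLaws Prod.fst edgeTarget (fun (p : Ω) (e : List α × α) => δ p e.2)
      (fun w p => w.length = m ∧ ∃ o, p = w.foldl δ o) := by
    refine ⟨?_, ?_, ?_⟩
    · rintro ⟨w, a⟩ p ⟨hw, o, rfl⟩
      refine ⟨by simpa [edgeTarget] using hw, ?_⟩
      cases w with
      | nil => exact ⟨_, rfl⟩
      | cons c w => exact ⟨δ o c, by simp [edgeTarget]⟩
    · rintro w p x y ⟨hw, o, rfl⟩ hx hy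
      obtain ⟨x, rfl⟩ : ∃ x', x = wordEdges w x' := ⟨_, hx.eq_wordEdges⟩
      obtain ⟨y, rfl⟩ : ∃ y', y = wordEdges w y' := ⟨_, hy.eq_wordEdges⟩
      have := comm o w _ _ hw (hloop hx) (hloop hy)
      simpa only [List.foldl_append, foldl_wordEdges] using this
    · rintro w p x ⟨hw, o, rfl⟩ hx
      obtain ⟨x, rfl⟩ : ∃ x', x = wordEdges w x' := ⟨_, hx.eq_wordEdges⟩
      have := idem o w _ hw (hloop hx)
      simpa only [List.foldl_append, foldl_wordEdges] using this
  have hend : ∀ x : List α, (w ++ x).drop x.length = (w ++ x).rtake m := by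
    intro x
    rw [List.rtake]
    congr 1
    simp [hwm]
  have hpx := isPath_wordEdges w x
  have hpy := isPath_wordEdges w y
  rw [hend, ← hx, hsuf] at hpx
  rw [hend, ← hy] at hpy
  have := H.foldl_eq_of_mem_iff (p := w.foldl δ o) ⟨hwm, o, rfl⟩ hpx hpy (by
    rintro ⟨f, a⟩
    by_cases hf : f.length = w.length
    · rw [mem_wordEdges hf, mem_wordEdges hf, ← hx, ← hy]
      have := Set.ext_iff.1 hfac (f ++ [a])
      simpa [hf, hwm] using this
    · exact ⟨fun h => absurd (length_of_mem_wordEdges h) hf,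
        fun h => absurd (length_of_mem_wordEdges h) hf⟩)
  simp only [foldl_wordEdges] at this
  rw [hx, hy, List.foldl_append, List.foldl_append, this]

end Words

/-! ### Laws of testable actions and the pigeonhole on pairs of states -/

section Actions

variable {α σ : Type*}

/-- An action of words on `Option σ` by partial maps such that, for words `e` of length at least
`K`, the words `e g e` act as commuting idempotents. -/
structure TestableAction (δ : Option σ → α → Option σ) (K : ℕ) : Prop where
  step_none : ∀ a, δ none a = none
  comm : ∀ (o : Option σ) (e g h : List α), K ≤ e.length →
    (e ++ g ++ e ++ h ++ e).foldl δ o = (e ++ h ++ e ++ g ++ e).foldl δ o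
  idem : ∀ (o : Option σ) (e g : List α), K ≤ e.length → (e ++ g ++ e ++ g ++ e).foldl δ o = (e ++ g ++ e).foldl δ o

/-- The state `s` is reachable from the state `r`. -/
def Reach (δ : Option σ → α → Option σ) (r s : Option σ) : Prop := ∃ g : List α, g.foldl δ r = s

theorem reach_foldl (δ : Option σ → α → Option σ) (r : Option σ) (g : List α) :
    Reach δ r (g.foldl δ r) := ⟨g, rfl⟩

theorem Reach.trans {δ : Option σ → α → Option σ} {r s t : Option σ} (h : Reach δ r s)
    (h' : Reach δ s t) : Reach δ r t := by
  obtain ⟨g, rfl⟩ := h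
  obtain ⟨g', rfl⟩ := h'
  exact ⟨g ++ g', List.foldl_append⟩

/-- Among more than `n.choose 2` pairs of distinct states, two agree up to order. -/
theorem exists_pair_repeat [Finite σ] (f g : ℕ → Option σ) (m : ℕ) (hm : (Nat.card σ).choose 2 ≤ m)
    (hf : ∀ i ≤ m, f i ≠ none) (hg : ∀ i ≤ m, g i ≠ none) (hfg : ∀ i ≤ m, f i ≠ g i) :
    ∃ i j, i < j ∧ j ≤ m ∧ (f i = f j ∧ g i = g j ∨ f i = g j ∧ g i = f j) := by
  classical
  have := Fintype.ofFinite σ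
  let S : Finset (Option σ) := Finset.univ.map Function.Embedding.some
  have hS : ∀ o : Option σ, o ≠ none → o ∈ S := by
    intro o ho
    obtain ⟨p, rfl⟩ := Option.ne_none_iff_exists'.1 ho
    simp [S]
  have hcard : (S.powersetCard 2).card < (Finset.range (m + 1)).card := by
    rw [Finset.card_powersetCard, Finset.card_map, Finset.card_univ, ← Nat.card_eq_fintype_card,
      Finset.card_range]
    omega
  obtain ⟨i, hi, j, hj, hij, h⟩ := Finset.exists_ne_map_eq_of_card_lt_of_maps_to hcard
    (f := fun i => ({f i, g i} : Finset (Option σ))) (by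
      intro i hi
      have hi : i ≤ m := by simpa [Nat.lt_succ_iff] using hi
      simp only [Finset.mem_coe, Finset.mem_powersetCard]
      refine ⟨?_, Finset.card_pair (hfg i hi)⟩
      intro o ho
      rcases Finset.mem_insert.1 ho with rfl | ho
      · exact hS _ (hf i hi)
      · rw [Finset.mem_singleton.1 ho]
        exact hS _ (hg i hi))
  have h' : s(f i, g i) = s(f j, g j) := by
    have h2 : ({f i, g i} : Set (Option σ)) = {f j, g j} := by
      have := congrArg (fun s : Finset (Option σ) => (s : Set (Option σ))) h
      simpa using this
    rw [Sym2.eq_iff]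
    exact Set.pair_eq_pair_iff.1 h2
  simp only [Finset.mem_range] at hi hj
  rw [Sym2.eq_iff] at h'
  rcases lt_or_gt_of_ne hij with hlt | hlt
  · exact ⟨i, j, hlt, by omega, h'⟩
  · refine ⟨j, i, hlt, by omega, ?_⟩
    rcases h' with ⟨h1, h2⟩ | ⟨h1, h2⟩
    · exact Or.inl ⟨h1.symm, h2.symm⟩
    · exact Or.inr ⟨h2.symm, h1.symm⟩

namespace TestableAction

variable {δ : Option σ → α → Option σ} {K : ℕ} (H : TestableAction δ K)
include H

theorem foldl_none (w : List α) : w.foldl δ none = none := by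
  induction w with
  | nil => rfl
  | cons a w ih => rw [List.foldl_cons, H.step_none, ih]

theorem ne_none_of_foldl {o : Option σ} {w : List α} (h : w.foldl δ o ≠ none) : o ≠ none := by
  rintro rfl
  exact h (H.foldl_none w)

theorem ne_none_of_reach {r s : Option σ} (h : Reach δ r s) (hs : s ≠ none) : r ≠ none := by
  obtain ⟨g, rfl⟩ := h
  exact H.ne_none_of_foldl hs

/-- The `K`-th power of `b` is long enough for the laws and fixes every state fixed by `b`, so its
leading occurrence in the laws can be dropped. -/
theorem exists_stabilizer {b : List α} (hb : b ≠ []) : ∃ e : List α, ∀ r, b.foldl δ r = r →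
    e.foldl δ r = r ∧ ∀ g h,
      (g ++ e ++ h ++ e).foldl δ r = (h ++ e ++ g ++ e).foldl δ r ∧
      (g ++ e ++ g ++ e).foldl δ r = (g ++ e).foldl δ r := by
  refine ⟨(List.replicate K b).flatten, fun r hr => ?_⟩
  have hlen : K ≤ ((List.replicate K b).flatten).length := by
    have := List.length_pos_iff.2 hb
    simp only [List.length_flatten, List.map_replicate, List.sum_replicate, smul_eq_mul]
    exact Nat.le_mul_of_pos_right K this
  have he : ∀ k, ((List.replicate k b).flatten).foldl δ r = r := by
    intro k
    induction k with
    | zero => rfl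
    | succ k ih => rw [List.replicate_succ, List.flatten_cons, List.foldl_append, hr, ih]
  refine ⟨he K, fun g h => ⟨?_, ?_⟩⟩
  · have := H.comm r _ g h hlen
    simpa only [List.foldl_append, he] using this
  · have := H.idem r _ g hlen
    simpa only [List.foldl_append, he] using this

/-- Two states of a strongly connected component that are fixed by a nonempty word are equal. -/
theorem eq_of_fixed {r s : Option σ} {b : List α} (hb : b ≠ []) (hr : b.foldl δ r = r)
    (hs : b.foldl δ s = s) (hrs : Reach δ r s) (hsr : Reach δ s r) : r = s := by
  obtain ⟨e, he⟩ := H.exists_stabilizer hb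
  obtain ⟨g, hg⟩ := hrs
  obtain ⟨h, hh⟩ := hsr
  -- As `g` leads r to s and `h` leads s to r, idempotence at s shows that `h e` fixes r;
  -- commutation at r then reads r = s.
  have h1 := ((he r hr).2 g h).1
  have h2 := ((he s hs).2 h h).2
  simp only [List.foldl_append, hg, hh, (he r hr).1, (he s hs).1] at h1 h2
  rw [h2, hg, (he s hs).1] at h1
  exact h1

theorem eq_of_swapped {r s : Option σ} {b : List α} (hb : b ≠ []) (hr : b.foldl δ r = s)
    (hs : b.foldl δ s = r) : r = s :=
  H.eq_of_fixed (b := b ++ b) (by simp [hb]) (by rw [List.foldl_append, hr, hs])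
    (by rw [List.foldl_append, hs, hr]) ⟨b, hr⟩ ⟨b, hs⟩

/-- Two states that stay distinct while a long word is read are both fixed by one of its nonempty
factors. -/
theorem exists_fixed_factor [Finite σ] {p q : Option σ} {w : List α}
    (hw : (Nat.card σ).choose 2 ≤ w.length) (hp : w.foldl δ p ≠ none) (hq : w.foldl δ q ≠ none)
    (hpq : w.foldl δ p ≠ w.foldl δ q) :
    ∃ a b c, w = a ++ b ++ c ∧ b ≠ [] ∧
      b.foldl δ (a.foldl δ p) = a.foldl δ p ∧ b.foldl δ (a.foldl δ q) = a.foldl δ q := by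
  have hsplit : ∀ (i : ℕ) (o : Option σ),
      w.foldl δ o = (w.drop i).foldl δ ((w.take i).foldl δ o) := by
    intro i o
    rw [← List.foldl_append, List.take_append_drop]
  -- There is one more prefix of `w` than letters, hence more pairs than unordered pairs available.
  -- A recurrence in the opposite order is excluded by `eq_of_swapped`.
  obtain ⟨i, j, hij, hj, h⟩ := exists_pair_repeat (fun i => (w.take i).foldl δ p)
    (fun i => (w.take i).foldl δ q) w.length hw
    (fun i _ => H.ne_none_of_foldl (w := w.drop i) (by rwa [← hsplit]))
    (fun i _ => H.ne_none_of_foldl (w := w.drop i) (by rwa [← hsplit]))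
    (fun i _ h => hpq (by rw [hsplit i p, hsplit i q, h]))
  have htake : w.take j = w.take i ++ (w.drop i).take (j - i) := by
    rw [← List.take_add, Nat.add_sub_cancel' hij.le]
  have hb : (w.drop i).take (j - i) ≠ [] := by
    rw [← List.length_pos_iff]
    simp
    omega
  simp only [htake, List.foldl_append] at h
  refine ⟨w.take i, (w.drop i).take (j - i), w.drop j, ?_, hb, ?_⟩
  · rw [← htake, List.take_append_drop]
  · rcases h with h | h
    · exact ⟨h.1.symm, h.2.symm⟩
    · refine absurd (H.eq_of_swapped hb h.2.symm h.1.symm) fun h' => hpq ?_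
      rw [hsplit i p, hsplit i q, h']

end TestableAction
end Actions

/-! ### Idempotence of loops -/

section Idempotence

variable {α σ : Type*}

/-- The factor of the infinite word `W` between the positions `i` and `j`. -/
def segment (W : ℕ → α) (i j : ℕ) : List α := (List.range' i (j - i)).map W

theorem segment_append (W : ℕ → α) {i j k : ℕ} (hij : i ≤ j) (hjk : j ≤ k) :
    segment W i j ++ segment W j k = segment W i k := by
  obtain ⟨a, rfl⟩ := Nat.exists_eq_add_of_le hij
  obtain ⟨b, rfl⟩ := Nat.exists_eq_add_of_le hjk
  have h1 : i + a - i = a := by omega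
  have h2 : i + a + b - (i + a) = b := by omega
  have h3 : i + a + b - i = a + b := by omega
  have := List.range'_append (s := i) (m := a) (n := b) (step := 1)
  rw [one_mul] at this
  rw [segment, segment, segment, h1, h2, h3, ← List.map_append, this]

theorem segment_add_period {W : ℕ → α} {h : ℕ} (hW : ∀ k, W (k + h) = W k) (i j : ℕ) :
    segment W (i + h) (j + h) = segment W i j := by
  have h1 : j + h - (i + h) = j - i := by omega
  rw [segment, segment, h1]
  apply List.ext_getElem
  · simp
  · intro k h1 h2
    have := hW (i + k)
    simp only [List.getElem_map, List.getElem_range', one_mul]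
    rw [← this]
    congr 1
    omega

theorem length_segment (W : ℕ → α) (i j : ℕ) : (segment W i j).length = j - i := by
  simp [segment]

namespace TestableAction

variable {δ : Option σ → α → Option σ} {K : ℕ} (H : TestableAction δ K)
include H

/-- If a pair of states at distance `h` repeats while a word of period `h` is read, then all later
states at multiples of the distance `h` are in the same strongly connected component. -/
theorem reach_of_pair_repeat {W : ℕ → α} {h : ℕ} (hW : ∀ k, W (k + h) = W k) {s : ℕ → Option σ}
    (hs : ∀ i j, i ≤ j → (segment W i j).foldl δ (s i) = s j) {i j : ℕ} (hij : i < j)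
    (hne : s i ≠ s (i + h)) (hi : s i = s j) (hih : s (i + h) = s (j + h)) (l : ℕ) :
    Reach δ (s (i + (l + 1) * h)) (s (i + h)) := by
  have hreach : ∀ i j, i ≤ j → Reach δ (s i) (s j) := fun i j h => ⟨_, hs i j h⟩
  have hb : segment W i j ≠ [] := by
    rw [← List.length_pos_iff, length_segment]
    omega
  have hb1 := hs i j hij.le
  rw [← hi] at hb1
  have hb2 := hs (i + h) (j + h) (by omega)
  rw [segment_add_period hW, ← hih] at hb2
  -- Otherwise `s (i + h)` leads back to `s j = s i`, and two states of one component fixed by the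
  -- same word would coincide.
  have hjh : j ≤ i + h := by
    by_contra hcon
    refine hne (H.eq_of_fixed hb hb1 hb2 (hreach _ _ (by omega)) ?_)
    have := hreach (i + h) j (by omega)
    rwa [← hi] at this
  obtain ⟨e, he⟩ := H.exists_stabilizer hb
  have ht := hs j (i + h) hjh
  rw [← hi] at ht
  have hper : ∀ l, (segment W i (i + l * h)).foldl δ (s (i + h)) = s (i + (l + 1) * h) := by
    intro l
    have := hs (i + h) (i + l * h + h) (by omega)
    rw [segment_add_period hW] at this
    rw [this]
    congr 1
    ring
  -- The induction step commutes, at `s i`, the segment from `j` to `i + h` with the one from `i` to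
  -- `i + (l + 1) * h`; both are led by `e` to `s (i + h)`.
  have key : ∀ l, e.foldl δ (s (i + (l + 1) * h)) = s (i + h) := by
    intro l
    induction l with
    | zero => simpa using (he _ hb2).1
    | succ l ih =>
      have h1 := ((he _ hb1).2 (segment W j (i + h)) (segment W i (i + (l + 1) * h))).1
      have h2 := ((he _ hb1).2 (segment W j (i + h)) []).2
      simp only [List.foldl_append, ht, (he _ hb2).1, hper, hs i (i + (l + 1) * h) (by omega), ih]
        at h1 h2
      rw [h1, h2]
  exact ⟨e, key l⟩

/-- If the conclusion fails, the states `s i` and `s (i + h)` differ for all `i ≤ m + h`. Suitably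
shifted, `m + 1` of these pairs are pairwise different as unordered pairs, which is too many. -/
theorem periodic_idem [Finite σ] {W : ℕ → α} {h : ℕ} (hh : 0 < h) (hW : ∀ k, W (k + h) = W k)
    {s : ℕ → Option σ} (hs : ∀ i j, i ≤ j → (segment W i j).foldl δ (s i) = s j) {m : ℕ}
    (hm : (Nat.card σ).choose 2 ≤ m) (hdef : s (m + h) ≠ none) :
    s (m + 2 * h) = s (m + h) := by
  classical
  by_contra hcon
  have hreach : ∀ i j, i ≤ j → Reach δ (s i) (s j) := fun i j h => ⟨_, hs i j h⟩
  have hshift : ∀ i j, i ≤ j → (segment W i j).foldl δ (s (i + h)) = s (j + h) := by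
    intro i j hij
    have := hs (i + h) (j + h) (by omega)
    rwa [segment_add_period hW] at this
  have hsdef : ∀ i ≤ m + h, s i ≠ none := by
    intro i hi
    exact H.ne_none_of_reach (hreach i _ hi) hdef
  have hne1 : ∀ i ≤ m + h, s i ≠ s (i + h) := by
    intro i hi heq
    apply hcon
    have h1 := hs i (m + h) hi
    have h2 := hshift i (m + h) hi
    rw [← heq, h1] at h2
    rw [h2]
    congr 1
    ring
  -- the pairs in one strongly connected component never repeat
  have hcomp : ∀ i j, i < j → Reach δ (s (i + h)) (s i) → s i ≠ s (i + h) →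
      ¬ (s i = s j ∧ s (i + h) = s (j + h) ∨ s i = s (j + h) ∧ s (i + h) = s j) := by
    intro i j hij hr hne hor
    have hb : segment W i j ≠ [] := by
      rw [← List.length_pos_iff, length_segment]
      omega
    have h1 := hs i j hij.le
    have h2 := hshift i j hij.le
    rcases hor with ⟨h3, h4⟩ | ⟨h3, h4⟩
    · rw [← h3] at h1
      rw [← h4] at h2
      exact hne (H.eq_of_fixed hb h1 h2 (hreach _ _ (by omega)) hr)
    · rw [← h4] at h1
      rw [← h3] at h2
      exact hne (H.eq_of_swapped hb h1 h2)
  -- `V i` says that from `i + h` on, the states at steps of `h` stay in one component. By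
  -- `reach_of_pair_repeat` a pair without this property does not recur later.
  let V : ℕ → Prop := fun i => ∀ l, Reach δ (s (i + (l + 1) * h)) (s (i + h))
  have hV : ∀ i j, i < j → j ≤ m → ¬ V i →
      ¬ (s i = s j ∧ s (i + h) = s (j + h) ∨ s i = s (j + h) ∧ s (i + h) = s j) := by
    intro i j hij hj hVi hor
    have hb : segment W i j ≠ [] := by
      rw [← List.length_pos_iff, length_segment]
      omega
    rcases hor with ⟨h3, h4⟩ | ⟨h3, h4⟩
    · exact hVi (H.reach_of_pair_repeat hW hs hij (hne1 i (by omega)) h3 h4)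
    · refine hne1 i (by omega) (H.eq_of_swapped hb ?_ ?_)
      · rw [hs i j hij.le, h4]
      · rw [hshift i j hij.le, h3]
  have hVh : ∀ i, V i → V (i + h) := by
    intro i hVi l
    refine Reach.trans ?_ (hreach (i + h) (i + h + h) (by omega))
    have := hVi (l + 1)
    rwa [show i + (l + 1 + 1) * h = i + h + (l + 1) * h by ring] at this
  have hVr : ∀ i, V i → Reach δ (s (i + h + h)) (s (i + h)) := by
    intro i hVi
    have := hVi 1
    rwa [show i + (1 + 1) * h = i + h + h by ring] at this
  -- Where `V i` holds, the pair is shifted by one period: it then lies within one component, where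
  -- `hcomp` excludes recurrence, and its second state is still defined.
  let φ : ℕ → ℕ := fun i => if V i then i + h else i
  have hφ : ∀ i ≤ m, φ i ≤ m + h := by
    intro i hi
    simp only [φ]
    split_ifs <;> omega
  obtain ⟨i, j, hij, hj, hor⟩ := exists_pair_repeat (fun i => s (φ i)) (fun i => s (φ i + h)) m hm
    (fun i hi => hsdef _ (hφ i hi))
    (fun i hi => by
      simp only [φ]
      split_ifs with hVi
      · exact H.ne_none_of_reach (hVr i hVi) (hsdef _ (by omega))
      · exact hsdef _ (by omega))
    (fun i hi => hne1 _ (hφ i hi))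
  have hsymm : ∀ {i j : ℕ}, (s i = s j ∧ s (i + h) = s (j + h) ∨ s i = s (j + h) ∧ s (i + h) = s j) →
      (s j = s i ∧ s (j + h) = s (i + h) ∨ s j = s (i + h) ∧ s (j + h) = s i) := by
    intro i j hor
    rcases hor with ⟨h1, h2⟩ | ⟨h1, h2⟩
    · exact Or.inl ⟨h1.symm, h2.symm⟩
    · exact Or.inr ⟨h2.symm, h1.symm⟩
  -- A shifted pair equal to an unshifted one puts both in one component, so `hcomp` applies to the
  -- earlier of them. The positions differ since `V` is inherited by `i + h`.
  have hmixed : ∀ i j, i ≤ m → j ≤ m → V i → ¬ V j →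
      ¬ (s (i + h) = s j ∧ s (i + h + h) = s (j + h) ∨
        s (i + h) = s (j + h) ∧ s (i + h + h) = s j) := by
    intro i j hi hj hVi hVj hor
    rcases lt_trichotomy (i + h) j with hlt | rfl | hlt
    · exact hcomp _ _ hlt (hVr i hVi) (hne1 _ (by omega)) hor
    · exact hVj (hVh i hVi)
    · refine hcomp _ _ hlt ?_ (hne1 _ (by omega)) (hsymm hor)
      rcases hor with ⟨h1, h2⟩ | ⟨h1, h2⟩
      · rw [← h1, ← h2]
        exact hVr i hVi
      · rw [← h1, ← h2]
        exact hreach _ _ (by omega)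
  simp only [φ] at hor
  by_cases hVi : V i <;> by_cases hVj : V j
  · rw [if_pos hVi, if_pos hVj] at hor
    exact hcomp _ _ (by omega) (hVr i hVi) (hne1 _ (by omega)) hor
  · rw [if_pos hVi, if_neg hVj] at hor
    exact hmixed i j (by omega) hj hVi hVj hor
  · rw [if_neg hVi, if_pos hVj] at hor
    exact hmixed j i hj (by omega) hVj hVi (hsymm hor)
  · rw [if_neg hVi, if_neg hVj] at hor
    exact hV i j hij hj hVi hor

/-- Loops at long words are idempotent. -/
theorem loop_idem [Finite σ] {w x : List α} (hw : (Nat.card σ).choose 2 ≤ w.length)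
    (hx : w <:+ w ++ x) (p : Option σ) : (w ++ x ++ x).foldl δ p = (w ++ x).foldl δ p := by
  obtain ⟨c, hc⟩ := hx
  have hlen : c.length = x.length := by
    have := congrArg List.length hc
    simp at this
    omega
  rcases Nat.eq_zero_or_pos c.length with h0 | hpos
  · obtain rfl : x = [] := List.length_eq_zero_iff.1 (by omega)
    simp
  by_cases hdef : (w ++ x).foldl δ p = none
  · rw [List.foldl_append, hdef, H.foldl_none]
  -- From `c w = w x` it follows that `w`, `w x` and `w x x` are prefixes of the infinite power of
  -- `c`.
  let W : ℕ → α := fun i => c.get ⟨i % c.length, Nat.mod_lt _ hpos⟩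
  have hW : ∀ k, W (k + c.length) = W k := by
    intro k
    simp [W]
  have hWc : segment W 0 c.length = c := by
    apply List.ext_getElem
    · simp [length_segment]
    · intro k h1 h2
      simp [segment, W, Nat.mod_eq_of_lt h2]
  have hpow : ∀ L, segment W 0 (L * c.length) = (List.replicate L c).flatten := by
    intro L
    induction L with
    | zero => simp [segment]
    | succ L ih =>
      rw [List.replicate_succ, List.flatten_cons, ← ih,
        ← segment_append W (Nat.zero_le c.length) (by rw [add_mul, one_mul]; omega), hWc]
      congr 1
      have := segment_add_period hW 0 (L * c.length)
      rw [← this, add_mul, one_mul, zero_add]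
  have hcomm : ∀ L, ∃ y, w ++ y = (List.replicate L c).flatten ++ w := by
    intro L
    induction L with
    | zero => exact ⟨[], by simp⟩
    | succ L ih =>
      obtain ⟨y, hy⟩ := ih
      refine ⟨x ++ y, ?_⟩
      rw [← List.append_assoc, ← hc, List.append_assoc, hy, List.replicate_succ, List.flatten_cons,
        List.append_assoc]
  have hWw : segment W 0 w.length = w := by
    obtain ⟨y, hy⟩ := hcomm w.length
    rw [← hpow] at hy
    have hle : w.length ≤ w.length * c.length := Nat.le_mul_of_pos_right _ hpos
    rw [← segment_append W (Nat.zero_le w.length) hle, List.append_assoc] at hy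
    exact (List.append_inj_left hy (by simp [length_segment])).symm
  have hs : ∀ i j, i ≤ j → (segment W i j).foldl δ ((segment W 0 i).foldl δ p) =
      (segment W 0 j).foldl δ p := by
    intro i j hij
    rw [← List.foldl_append, segment_append W (Nat.zero_le i) hij]
  have hw1 : segment W 0 (w.length + c.length) = w ++ x := by
    rw [← hc, ← segment_append W (Nat.zero_le c.length) (by omega), hWc]
    have := segment_add_period hW 0 w.length
    rw [zero_add] at this
    rw [this, hWw]
  have hw2 : segment W 0 (w.length + 2 * c.length) = w ++ x ++ x := by
    rw [← segment_append W (Nat.zero_le c.length) (by omega), hWc]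
    have := segment_add_period hW 0 (w.length + c.length)
    rw [zero_add, show w.length + c.length + c.length = w.length + 2 * c.length by ring] at this
    rw [this, hw1, ← List.append_assoc, hc]
  have := H.periodic_idem hpos hW hs hw (by rwa [hw1])
  rwa [hw1, hw2] at this

end TestableAction
end Idempotence

/-! ### Commutation of loops -/

section Commutation

variable {α σ : Type*}

theorem suffix_append_loops {w x y : List α} (hx : w <:+ w ++ x) (hy : w <:+ w ++ y) :
    w <:+ w ++ (x ++ y) := by
  obtain ⟨x', hx⟩ := hx
  obtain ⟨y', hy⟩ := hy
  exact ⟨x' ++ y', by rw [← List.append_assoc, ← hx, List.append_assoc, hy, List.append_assoc]⟩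

theorem exists_append_eq_replicate {w z : List α} (hz : w <:+ w ++ z) (hne : z ≠ []) :
    ∃ v M, v ++ w = (List.replicate M z).flatten := by
  have hM : ∀ M, w <:+ w ++ (List.replicate M z).flatten := by
    intro M
    induction M with
    | zero => simp
    | succ M ih =>
      rw [List.replicate_succ, List.flatten_cons]
      exact suffix_append_loops hz ih
  obtain ⟨v, hv⟩ : w <:+ (List.replicate w.length z).flatten := by
    refine List.suffix_of_suffix_length_le (hM w.length) (List.suffix_append _ _) ?_
    simp only [List.length_flatten, List.map_replicate, List.sum_replicate, smul_eq_mul]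
    exact Nat.le_mul_of_pos_right _ (List.length_pos_iff.2 hne)
  exact ⟨v, _, hv⟩

theorem foldl_replicate_flatten {Ω : Type*} {δ : Ω → α → Ω} {o : Ω} {z : List α}
    (hz : z.foldl δ o = o) (M : ℕ) : (List.replicate M z).flatten.foldl δ o = o := by
  induction M with
  | zero => rfl
  | succ M ih => rw [List.replicate_succ, List.flatten_cons, List.foldl_append, hz, ih]

namespace TestableAction

variable {δ : Option σ → α → Option σ} {K : ℕ} (H : TestableAction δ K)
include H

/-- Two distinct states in a strongly connected component cannot both survive a long word and stay
distinct. -/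
theorem foldl_eq_of_reach [Finite σ] {p q : Option σ} {w : List α}
    (hw : (Nat.card σ).choose 2 ≤ w.length) (hp : w.foldl δ p ≠ none) (hq : w.foldl δ q ≠ none)
    (hpq : Reach δ (w.foldl δ p) q) (hqp : Reach δ (w.foldl δ q) p) :
    w.foldl δ p = w.foldl δ q := by
  by_contra hne
  obtain ⟨a, b, c, rfl, hb, h1, h2⟩ := H.exists_fixed_factor hw hp hq hne
  have hr : ∀ o, Reach δ (a.foldl δ o) ((a ++ b ++ c).foldl δ o) := fun o =>
    ⟨b ++ c, by simp only [List.foldl_append]⟩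
  have := H.eq_of_fixed hb h1 h2 ((hr p).trans (hpq.trans (reach_foldl δ q a)))
    ((hr q).trans (hqp.trans (reach_foldl δ p a)))
  exact hne (by simp only [List.foldl_append, this])

/-- The state `o` reached is fixed by `x y`, so `o` and its image under `x` lie in one component.
Both are targets of the long word `w` from states of that component, so `foldl_eq_of_reach`
identifies them. -/
theorem loop_absorb [Finite σ] {w x y : List α} (hw : (Nat.card σ).choose 2 ≤ w.length)
    (hx : w <:+ w ++ x) (hy : w <:+ w ++ y) (p : Option σ) (hdef : (w ++ x ++ y).foldl δ p ≠ none) :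
    (w ++ x ++ y ++ x).foldl δ p = (w ++ x ++ y).foldl δ p := by
  by_cases hz : x ++ y = []
  · obtain ⟨rfl, rfl⟩ := List.append_eq_nil_iff.1 hz
    simp
  obtain ⟨v, M, hv⟩ := exists_append_eq_replicate (suffix_append_loops hx hy) hz
  have hidem := H.loop_idem hw (suffix_append_loops hx hy) p
  obtain ⟨x', hx'⟩ := hx
  set o := (w ++ x ++ y).foldl δ p with ho
  have hoxy : (x ++ y).foldl δ o = o := by
    rw [ho, ← List.foldl_append]
    simpa only [List.append_assoc] using hidem
  have hvw : w.foldl δ (v.foldl δ o) = o := by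
    rw [← List.foldl_append, hv]
    exact foldl_replicate_flatten hoxy M
  have hx'w : w.foldl δ (x'.foldl δ (v.foldl δ o)) = x.foldl δ o := by
    rw [← List.foldl_append, hx', List.foldl_append, hvw]
  have hyo : y.foldl δ (x.foldl δ o) = o := by rw [← List.foldl_append, hoxy]
  have := H.foldl_eq_of_reach (p := v.foldl δ o) (q := x'.foldl δ (v.foldl δ o)) hw
    (by rwa [hvw]) (by rw [hx'w]; exact H.ne_none_of_foldl (w := y) (by rwa [hyo]))
    (by rw [hvw]; exact (reach_foldl δ o v).trans (reach_foldl δ _ x'))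
    (by rw [hx'w]; exact Reach.trans ⟨y, hyo⟩ (reach_foldl δ o v))
  rw [hvw, hx'w] at this
  rw [List.foldl_append, ← ho, ← this]

/-- If the pair of states consisting of `p` and of the target of the word `w ++ g` survives the long
word `w`, then the latter state is reachable from the target of another word `w ++ h` that
fixes it. -/
theorem reach_of_long_word [Finite σ] {p d : Option σ} {w g h : List α}
    (hw : (Nat.card σ).choose 2 ≤ w.length) (hg : (w ++ g).foldl δ p = d)
    (hd : (w ++ h).foldl δ d = d) (hdef : w.foldl δ d ≠ none) (hne : w.foldl δ p ≠ w.foldl δ d) :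
    Reach δ ((w ++ h).foldl δ p) d := by
  have hp : w.foldl δ p ≠ none := by
    refine H.ne_none_of_foldl (w := g) ?_
    rw [← List.foldl_append, hg]
    exact H.ne_none_of_foldl hdef
  obtain ⟨a, b, c, rfl, hb, h1, h2⟩ := H.exists_fixed_factor hw hp hdef hne
  obtain ⟨e, he⟩ := H.exists_stabilizer hb
  -- Read from the state after `a`, the left side ends at the image of `d` under `a`, while the
  -- right side first passes through the target of `w h` from `p`.
  have h3 := ((he _ h1).2 (c ++ g ++ a) (c ++ h ++ a)).1
  simp only [List.foldl_append] at hg hd h1 h2 h3 ⊢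
  have h4 : c.foldl δ (a.foldl δ p) = c.foldl δ (b.foldl δ (a.foldl δ p)) := by rw [h1]
  have h5 : c.foldl δ (a.foldl δ d) = c.foldl δ (b.foldl δ (a.foldl δ d)) := by rw [h2]
  rw [h4, hg, (he _ h2).1, h5, hd, (he _ h2).1] at h3
  have hda : Reach δ (a.foldl δ d) d := ⟨b ++ c ++ h, by simp only [List.foldl_append, hd]⟩
  refine Reach.trans ?_ hda
  rw [h3]
  exact ⟨a ++ e ++ (c ++ g ++ a) ++ e, by simp only [List.foldl_append]⟩

/-- Loops at long words commute. -/
theorem loop_comm [Finite σ] {w x y : List α} (hw : (Nat.card σ).choose 2 ≤ w.length)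
    (hx : w <:+ w ++ x) (hy : w <:+ w ++ y) (p : Option σ) :
    (w ++ x ++ y).foldl δ p = (w ++ y ++ x).foldl δ p := by
  -- each of the two products leads to a state fixed by both loops
  have hfix : ∀ {x y : List α}, w <:+ w ++ x → w <:+ w ++ y →
      x.foldl δ ((w ++ x ++ y).foldl δ p) = (w ++ x ++ y).foldl δ p ∧
      y.foldl δ ((w ++ x ++ y).foldl δ p) = (w ++ x ++ y).foldl δ p := by
    intro x y hx hy
    by_cases hdef : (w ++ x ++ y).foldl δ p = none
    · rw [hdef, H.foldl_none, H.foldl_none]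
      exact ⟨rfl, rfl⟩
    · refine ⟨by rw [← List.foldl_append, H.loop_absorb hw hx hy p hdef], ?_⟩
      obtain ⟨x', hx'⟩ := hx
      rw [← List.foldl_append, ← hx', List.append_assoc x', List.append_assoc x', List.foldl_append,
        H.loop_idem hw hy, ← List.foldl_append]
  by_contra hcon
  have hz : x ++ y ≠ [] := by
    intro hz
    obtain ⟨rfl, rfl⟩ := List.append_eq_nil_iff.1 hz
    exact hcon rfl
  obtain ⟨v, M, hv⟩ := exists_append_eq_replicate (suffix_append_loops hx hy) hz
  have hvw : ∀ o, x.foldl δ o = o → y.foldl δ o = o → w.foldl δ (v.foldl δ o) = o := by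
    intro o h1 h2
    rw [← List.foldl_append, hv]
    exact foldl_replicate_flatten (by rw [List.foldl_append, h1, h2]) M
  -- If the two products lead to different states and one of these is defined, it is reachable from
  -- the other: `reach_of_long_word` applies to `d`, the image of the defined state under `v`, which
  -- `w` leads back to that state.
  have main : ∀ {x y : List α}, w <:+ w ++ x → w <:+ w ++ y →
      (∀ o, x.foldl δ o = o → y.foldl δ o = o → w.foldl δ (v.foldl δ o) = o) →
      (w ++ x ++ y).foldl δ p ≠ none →
      (w ++ x ++ y).foldl δ p ≠ (w ++ y ++ x).foldl δ p →
      Reach δ ((w ++ y ++ x).foldl δ p) ((w ++ x ++ y).foldl δ p) := by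
    intro x y hx hy hvw hdef hne
    obtain ⟨h1, h2⟩ := hfix hx hy
    set o := (w ++ x ++ y).foldl δ p with ho
    have h3 := hvw o h1 h2
    have := H.reach_of_long_word (p := p) (d := v.foldl δ o) (g := x ++ y ++ v) (h := y ++ x ++ v)
      hw (by simp only [ho, List.foldl_append]) (by
        rw [List.foldl_append, h3, List.foldl_append, List.foldl_append, h2, h1])
      (by rwa [h3]) (by
        rw [h3]
        intro h
        apply hne
        rw [List.foldl_append, List.foldl_append, h, h2, h1])
    refine Reach.trans ?_ (Reach.trans this ⟨w, h3⟩)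
    exact ⟨v, by simp only [List.foldl_append]⟩
  -- By symmetry the two states lie in one component, and both are targets of `w` from it, hence
  -- they are equal.
  have final : ∀ {x y : List α}, w <:+ w ++ x → w <:+ w ++ y →
      (∀ o, x.foldl δ o = o → y.foldl δ o = o → w.foldl δ (v.foldl δ o) = o) →
      (w ++ x ++ y).foldl δ p ≠ none →
      (w ++ x ++ y).foldl δ p ≠ (w ++ y ++ x).foldl δ p → False := by
    intro x y hx hy hvw hdef hne
    have hr1 := main hx hy hvw hdef hne
    have hdef' := H.ne_none_of_reach hr1 hdef
    have hr2 := main hy hx (fun o h1 h2 => hvw o h2 h1) hdef' hne.symm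
    have h1 := hvw _ (hfix hx hy).1 (hfix hx hy).2
    have h2 := hvw _ (hfix hy hx).2 (hfix hy hx).1
    have := H.foldl_eq_of_reach (p := v.foldl δ ((w ++ x ++ y).foldl δ p))
      (q := v.foldl δ ((w ++ y ++ x).foldl δ p)) hw (by rwa [h1]) (by rwa [h2])
      (by rw [h1]; exact hr2.trans (reach_foldl δ _ v))
      (by rw [h2]; exact hr1.trans (reach_foldl δ _ v))
    rw [h1, h2] at this
    exact hne this
  by_cases hdef : (w ++ x ++ y).foldl δ p = none
  · refine final hy hx (fun o h1 h2 => hvw o h2 h1) ?_ (Ne.symm hcon)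
    rw [← hdef]
    exact Ne.symm hcon
  · exact final hx hy hvw hdef hcon

/-- Words with the same local data act in the same way. -/
theorem foldl_eq_of_sameLocalData [Finite σ] {m : ℕ} (hm : (Nat.card σ).choose 2 ≤ m)
    {u v : List α} (huv : SameLocalData (m + 1) u v) (o : Option σ) :
    u.foldl δ o = v.foldl δ o := by
  refine LocalTestability.foldl_eq_of_sameLocalData δ m ?_ ?_ huv o
  · intro o w x y hw hx hy
    exact H.loop_comm (hw ▸ hm) hx hy o
  · intro o w x hw hx
    exact H.loop_idem (hw ▸ hm) hx o

end TestableAction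
end Commutation

/-! ### Local data of words with a long repeated factor -/

section LocalData

variable {α : Type*}

/-- An occurrence that meets both `X` and `Y` covers `e` and a letter on each side, so it has length
at least `e.length + 2`. -/
theorem infix_append_append_iff {f X e Y : List α} (hf : f.length ≤ e.length + 1) :
    f <:+: X ++ (e ++ Y) ↔ f <:+: X ++ e ∨ f <:+: e ++ Y := by
  constructor
  · rintro ⟨s, t, h⟩
    by_cases hlen : s.length + f.length ≤ X.length + e.length
    · left
      have : s ++ f <+: X ++ e := by
        refine List.prefix_of_prefix_length_le (l₃ := X ++ (e ++ Y)) ?_ ?_ (by simpa using hlen)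
        · exact ⟨t, h⟩
        · exact ⟨Y, by simp⟩
      exact (List.suffix_append s f).isInfix.trans this.isInfix
    · right
      obtain ⟨s', rfl⟩ : X <+: s := by
        refine List.prefix_of_prefix_length_le (l₃ := X ++ (e ++ Y)) (List.prefix_append _ _) ?_
          (by omega)
        exact ⟨f ++ t, by rw [← h]; simp⟩
      refine ⟨s', t, ?_⟩
      simpa using h
  · rintro (h | h)
    · exact h.trans ⟨[], Y, by simp⟩
    · exact h.trans ⟨X, [], by simp⟩

theorem rtake_append_of_le_length {n : ℕ} {X Y : List α} (h : n ≤ Y.length) :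
    (X ++ Y).rtake n = Y.rtake n := by
  rw [List.rtake, List.rtake, List.length_append, Nat.add_sub_assoc h, ← List.drop_drop,
    List.drop_left]

/-- The local data of a word of the form `e X e`, with `e` long, placed in a context. -/
theorem sameLocalData_of_factors {k : ℕ} {p e X Y z : List α} (hk : k ≤ e.length + 1)
    (h : ∀ f : List α, f.length = k → (f <:+: e ++ (X ++ e) ↔ f <:+: e ++ (Y ++ e))) :
    SameLocalData k (p ++ (e ++ (X ++ (e ++ z)))) (p ++ (e ++ (Y ++ (e ++ z)))) := by
  refine ⟨?_, ?_, ?_⟩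
  · have : ∀ X, p ++ (e ++ (X ++ (e ++ z))) = (p ++ e) ++ (X ++ (e ++ z)) := by simp
    have hlen : k - 1 ≤ (p ++ e).length := by simp; omega
    rw [this X, this Y, List.take_append_of_le_length hlen, List.take_append_of_le_length hlen]
  · have : ∀ X, p ++ (e ++ (X ++ (e ++ z))) = (p ++ (e ++ X)) ++ (e ++ z) := by simp
    have hlen : k - 1 ≤ (e ++ z).length := by simp; omega
    rw [this X, this Y, rtake_append_of_le_length hlen, rtake_append_of_le_length hlen]
  · have hsplit : ∀ (X f : List α), f.length = k → (f <:+: p ++ (e ++ (X ++ (e ++ z))) ↔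
        f <:+: p ++ e ∨ f <:+: e ++ (X ++ e) ∨ f <:+: e ++ z) := by
      intro X f hf
      rw [infix_append_append_iff (by omega), ← List.append_assoc e X,
        infix_append_append_iff (by omega), List.append_assoc]
    ext f
    simp only [Set.mem_ofPred_eq]
    refine and_congr_left fun hf => ?_
    rw [hsplit X f hf, hsplit Y f hf, h f hf]

theorem sameLocalData_swap {k : ℕ} {e : List α} (hk : k ≤ e.length + 1) (p g h z : List α) :
    SameLocalData k (p ++ (e ++ (g ++ (e ++ h) ++ (e ++ z))))
      (p ++ (e ++ (h ++ (e ++ g) ++ (e ++ z)))) := by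
  refine sameLocalData_of_factors hk fun f hf => ?_
  have : ∀ g h : List α, f <:+: e ++ (g ++ (e ++ h) ++ e) ↔
      f <:+: e ++ (g ++ e) ∨ f <:+: e ++ (h ++ e) := by
    intro g h
    rw [show e ++ (g ++ (e ++ h) ++ e) = (e ++ g) ++ (e ++ (h ++ e)) by simp,
      infix_append_append_iff (by omega), List.append_assoc]
  rw [this, this, or_comm]

theorem sameLocalData_double {k : ℕ} {e : List α} (hk : k ≤ e.length + 1) (p g z : List α) :
    SameLocalData k (p ++ (e ++ (g ++ (e ++ g) ++ (e ++ z)))) (p ++ (e ++ (g ++ (e ++ z)))) := by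
  refine sameLocalData_of_factors hk fun f hf => ?_
  rw [show e ++ (g ++ (e ++ g) ++ e) = (e ++ g) ++ (e ++ (g ++ e)) by simp,
      infix_append_append_iff (by omega), List.append_assoc, or_self]

end LocalData

/-! ### From reduced testable automata to testable actions; the upper bound -/

namespace PartialDFA

variable {α σ : Type*} (A : PartialDFA α σ)

theorem run_append (p : σ) (u v : List α) :
    A.run p (u ++ v) = (A.run p u).bind fun q => A.run q v := by
  induction u generalizing p with
  | nil => rfl
  | cons a u ih =>
    simp only [List.cons_append, run, Option.bind_assoc]
    congr 1
    funext q
    exact ih q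

theorem append_mem_acceptsFrom {p q : σ} {u : List α} (h : A.run p u = some q) (v : List α) :
    u ++ v ∈ A.acceptsFrom p ↔ v ∈ A.acceptsFrom q := by
  change (∃ r ∈ A.accept, A.run p (u ++ v) = some r) ↔ ∃ r ∈ A.accept, A.run q v = some r
  rw [run_append, h]
  rfl

open Classical in
/-- The transitions of the automaton, from which those into states that accept no word are
removed. -/
noncomputable def liveStep (o : Option σ) (a : α) : Option σ :=
  o.bind fun p => (A.step p a).filter fun q => decide (∃ w, w ∈ A.acceptsFrom q)

theorem foldl_liveStep_none (w : List α) : w.foldl A.liveStep none = none := by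
  induction w with
  | nil => rfl
  | cons a w ih => exact ih

/-- An accepted word never visits a state that accepts nothing, so the pruning loses no word. It is
needed because a reduced automaton may have one such state, which no context distinguishes from an
undefined transition. -/
theorem mem_acceptsFrom_iff (p : σ) (w : List α) :
    w ∈ A.acceptsFrom p ↔ ∃ q ∈ A.accept, w.foldl A.liveStep (some p) = some q := by
  induction w generalizing p with
  | nil => exact Iff.rfl
  | cons a w ih =>
    cases hs : A.step p a with
    | none =>
      have h1 : A.liveStep (some p) a = none := by simp [liveStep, hs]
      rw [List.foldl_cons, h1, foldl_liveStep_none]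
      change (∃ r ∈ A.accept, A.run p (a :: w) = some r) ↔ _
      simp [run, hs]
    | some q =>
      have h2 : a :: w ∈ A.acceptsFrom p ↔ w ∈ A.acceptsFrom q :=
        A.append_mem_acceptsFrom (u := [a]) (by simp [run, hs]) w
      rw [List.foldl_cons, h2]
      by_cases hq : ∃ w, w ∈ A.acceptsFrom q
      · have h1 : A.liveStep (some p) a = some q := by simp [liveStep, hs, hq]
        rw [h1]
        exact ih q
      · have h1 : A.liveStep (some p) a = none := by
          simp only [liveStep, Option.bind_some, hs]
          rw [Option.filter_eq_none_iff]
          simpa using hq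
        rw [h1, foldl_liveStep_none]
        exact ⟨fun h => absurd ⟨w, h⟩ hq, by simp⟩

theorem exists_mem_of_liveStep {o : Option σ} {a : α} {q : σ} (h : A.liveStep o a = some q) :
    ∃ w, w ∈ A.acceptsFrom q := by
  obtain ⟨p, -, h⟩ := Option.bind_eq_some_iff.1 h
  simpa using (Option.filter_eq_some_iff.1 h).2

theorem exists_mem_of_foldl_liveStep {o : Option σ} {u : List α} (hu : u ≠ []) {q : σ}
    (h : u.foldl A.liveStep o = some q) : ∃ w, w ∈ A.acceptsFrom q := by
  obtain ⟨u, a, rfl⟩ : ∃ u' a, u = u' ++ [a] := ⟨_, _, (List.dropLast_append_getLast hu).symm⟩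
  rw [List.foldl_append] at h
  exact A.exists_mem_of_liveStep h

variable {A}

/-- Nonempty words that behave in the same way in all contexts act in the same way. -/
theorem IsReduced.foldl_liveStep_eq (hA : A.IsReduced) {u v : List α} (hu : u ≠ []) (hv : v ≠ [])
    (huv : ∀ p z, p ++ (u ++ z) ∈ A.accepts ↔ p ++ (v ++ z) ∈ A.accepts) (o : Option σ) :
    u.foldl A.liveStep o = v.foldl A.liveStep o := by
  have hsub : ∀ {u v : List α}, u ≠ [] → v ≠ [] →
      (∀ p z, p ++ (u ++ z) ∈ A.accepts ↔ p ++ (v ++ z) ∈ A.accepts) → ∀ p q,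
      u.foldl A.liveStep (some p) = some q → v.foldl A.liveStep (some p) = some q := by
    intro u v hu hv huv p q hq
    obtain ⟨w0, hw0⟩ := hA.1 p
    have hacc : ∀ z, u ++ z ∈ A.acceptsFrom p ↔ v ++ z ∈ A.acceptsFrom p := by
      intro z
      rw [← A.append_mem_acceptsFrom hw0, ← A.append_mem_acceptsFrom hw0]
      exact huv w0 z
    have hst : ∀ {u : List α} {q : σ}, u.foldl A.liveStep (some p) = some q → ∀ z,
        (u ++ z ∈ A.acceptsFrom p ↔ z ∈ A.acceptsFrom q) := by
      intro u q h z
      rw [mem_acceptsFrom_iff, mem_acceptsFrom_iff, List.foldl_append, h]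
    -- Since `u` is nonempty, `q` has survived the pruning and accepts some `z`, which forces `v` to
    -- be defined at `p` too.
    obtain ⟨z, hz⟩ := A.exists_mem_of_foldl_liveStep hu hq
    have hz' := (hacc z).1 ((hst hq z).2 hz)
    cases hq' : v.foldl A.liveStep (some p) with
    | none =>
      exfalso
      rw [mem_acceptsFrom_iff, List.foldl_append, hq'] at hz'
      obtain ⟨r, -, hr⟩ := hz'
      rw [foldl_liveStep_none] at hr
      cases hr
    | some q' =>
      congr 1
      apply hA.2
      ext z
      rw [← hst hq', ← hst hq, hacc]
  cases o with
  | none =>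
    rw [foldl_liveStep_none, foldl_liveStep_none]
  | some p =>
    cases hq : u.foldl A.liveStep (some p) with
    | some q => exact (hsub hu hv huv p q hq).symm
    | none =>
      cases hq' : v.foldl A.liveStep (some p) with
      | none => rfl
      | some q' =>
        rw [hsub hv hu (fun p z => (huv p z).symm) p q' hq'] at hq
        cases hq

theorem IsReduced.testableAction (hA : A.IsReduced) {k : ℕ} (hk : IsKTestable A.accepts k) :
    TestableAction A.liveStep k := by
  obtain ⟨hk1, hk⟩ := hk
  have hne : ∀ {e : List α}, k ≤ e.length → e ≠ [] := by
    rintro e he rfl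
    simp at he
    omega
  refine ⟨fun a => rfl, ?_, ?_⟩
  · intro o e g h he
    refine hA.foldl_liveStep_eq (by simp [hne he]) (by simp [hne he]) ?_ o
    intro p z
    have := sameLocalData_swap (k := k) (e := e) (by omega) p g h z
    simpa using hk _ _ (by simp [hne he]) (by simp [hne he]) this
  · intro o e g he
    refine hA.foldl_liveStep_eq (by simp [hne he]) (by simp [hne he]) ?_ o
    intro p z
    have := sameLocalData_double (k := k) (e := e) (by omega) p g z
    simpa using hk _ _ (by simp [hne he]) (by simp [hne he]) this

theorem order_le {k : ℕ} (hk : IsKTestable A.accepts k) : A.order ≤ k := Nat.sInf_le hk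

/-- The upper bound for the order of local testability. -/
theorem IsReduced.order_le [Finite σ] (hA : A.IsReduced) (ht : A.IsLocallyTestable) :
    A.order ≤ (Nat.card σ).choose 2 + 1 := by
  obtain ⟨k, hk⟩ := ht
  refine PartialDFA.order_le ⟨by omega, fun u v _ _ huv => ?_⟩
  have := (hA.testableAction hk).foldl_eq_of_sameLocalData le_rfl huv (some A.start)
  change u ∈ A.acceptsFrom A.start ↔ v ∈ A.acceptsFrom A.start
  rw [mem_acceptsFrom_iff, mem_acceptsFrom_iff, this]

end PartialDFA

/-! ### A sufficient condition for testability -/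

namespace PartialDFA

variable {α σ : Type*} (A : PartialDFA α σ)

theorem run_eq_foldl (p : σ) (w : List α) :
    A.run p w = w.foldl (fun o a => o.bind fun q => A.step q a) (some p) := by
  have hnone : ∀ w : List α, w.foldl (fun o a => o.bind fun q => A.step q a) none = none := by
    intro w
    induction w with
    | nil => rfl
    | cons a w ih => exact ih
  induction w generalizing p with
  | nil => rfl
  | cons a w ih =>
    rw [List.foldl_cons, run, Option.bind_some]
    cases A.step p a with
    | none => exact (hnone w).symm
    | some q => exact ih q

/-- If words of length `m` lead to at most one state, then the automaton is testable. -/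
theorem isKTestable_of_rank_le_one {m : ℕ}
    (h : ∀ (w : List α) (p q p' q' : σ), w.length = m → A.run p w = some p' →
      A.run q w = some q' → p' = q') : IsKTestable A.accepts (m + 1) := by
  refine ⟨by omega, fun u v _ _ huv => ?_⟩
  set δ : Option σ → α → Option σ := fun o a => o.bind fun q => A.step q a
  have hnone : ∀ w : List α, w.foldl δ none = none := by
    intro w
    induction w with
    | nil => rfl
    | cons a w ih => exact ih
  -- The word `w x` ends in `w`, which has at most one target, so a loop either fixes the state
  -- behind `w` or is undefined there; such loops trivially commute and are idempotent.
  have hloop : ∀ (o : Option σ) (w x : List α), w.length = m → w <:+ w ++ x →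
      x.foldl δ (w.foldl δ o) = none ∨ x.foldl δ (w.foldl δ o) = w.foldl δ o := by
    rintro o w x hw ⟨x', hx⟩
    by_cases hdef : x.foldl δ (w.foldl δ o) = none
    · exact Or.inl hdef
    right
    have hdef' : w.foldl δ (x'.foldl δ o) ≠ none := by
      rwa [← List.foldl_append, hx, List.foldl_append]
    rw [← List.foldl_append, ← hx, List.foldl_append]
    have hq : ∀ o, w.foldl δ o ≠ none → ∃ p q, o = some p ∧ A.run p w = some q := by
      intro o ho
      cases o with
      | none => exact absurd (hnone w) ho
      | some p =>
        obtain ⟨q, hq⟩ := Option.ne_none_iff_exists'.1 ho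
        exact ⟨p, q, rfl, by rw [run_eq_foldl]; exact hq⟩
    obtain ⟨p, q, hp, hpq⟩ := hq _ hdef'
    obtain ⟨p', q', rfl, hpq'⟩ := hq o (fun h0 => hdef (by rw [h0, hnone]))
    have := h w p p' q q' hw hpq hpq'
    rw [hp]
    rw [run_eq_foldl] at hpq hpq'
    exact hpq.trans ((congrArg some this).trans hpq'.symm)
  have := foldl_eq_of_sameLocalData δ m (fun o w x y hw hx hy => by
      simp only [List.foldl_append]
      rcases hloop o w x hw hx with h1 | h1 <;> rcases hloop o w y hw hy with h2 | h2 <;>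
        simp only [h1, h2, hnone])
    (fun o w x hw hx => by
      simp only [List.foldl_append]
      rcases hloop o w x hw hx with h1 | h1 <;> simp only [h1, hnone]) huv (some A.start)
  change (∃ r ∈ A.accept, A.run A.start u = some r) ↔ ∃ r ∈ A.accept, A.run A.start v = some r
  rw [run_eq_foldl, run_eq_foldl]
  simp only [δ] at this
  rw [this]

variable {A}

theorem order_eq {m : ℕ} (h : IsKTestable A.accepts (m + 1))
    (h' : ∀ k, IsKTestable A.accepts k → m < k) : A.order = m + 1 :=
  le_antisymm (order_le h) (h' _ (Nat.sInf_mem (s := {k | IsKTestable A.accepts k}) ⟨_, h⟩))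

end PartialDFA

/-! ### The extremal automaton -/

section AutomatonM

variable {n : ℕ}

/-- The letter `b i j` of the automaton `M`. -/
def mLetter (i j : Fin n) (hij : i < j) (hi : i.val + 2 < n) : MLetter n := some ⟨(i, j), hij, hi⟩

theorem mStep_eq_none {i j p : Fin n} {hij : i < j} {hi : i.val + 2 < n} (h1 : p ≠ i)
    (h2 : p ≠ j) : mStep p (mLetter i j hij hi) = none := by
  simp [mStep, mLetter, h1, h2]

theorem mStep_left {i j : Fin n} {hij : i < j} {hi : i.val + 2 < n} (hj : j.val + 1 < n) :
    mStep i (mLetter i j hij hi) = some i := by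
  simp [mStep, mLetter, hj]

theorem mStep_right {i j : Fin n} {hij : i < j} {hi : i.val + 2 < n} (hj : j.val + 1 < n) :
    mStep j (mLetter i j hij hi) = some ⟨j.val + 1, hj⟩ := by
  simp [mStep, mLetter, hj, hij.ne']

theorem mStep_left_last {i j : Fin n} {hij : i < j} {hi : i.val + 2 < n} (hj : j.val + 1 = n) :
    mStep i (mLetter i j hij hi) = some ⟨i.val + 1, by omega⟩ := by
  simp [mStep, mLetter, hj]

theorem mStep_right_last {i j : Fin n} {hij : i < j} {hi : i.val + 2 < n} (hj : j.val + 1 = n) :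
    mStep j (mLetter i j hij hi) = some ⟨i.val + 2, hi⟩ := by
  simp [mStep, mLetter, hj, hij.ne']

theorem mStep_ne_none {i j : Fin n} {hij : i < j} {hi : i.val + 2 < n} {p : Fin n}
    (hp : p = i ∨ p = j) : mStep p (mLetter i j hij hi) ≠ none := by
  by_cases hj : j.val + 1 < n
  · rcases hp with rfl | rfl
    · simp [mStep_left hj]
    · simp [mStep_right hj]
  · have hj : j.val + 1 = n := by omega
    rcases hp with rfl | rfl
    · simp [mStep_left_last hj]
    · simp [mStep_right_last hj]

/-- Pairs of states move forward in the lexicographic order. -/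
theorem mStep_pair {p q p' q' : Fin n} {l : MLetter n} (hpq : p < q) (hp : mStep p l = some p')
    (hq : mStep q l = some q') :
    p' < q' ∧ p.val * n + q.val < p'.val * n + q'.val := by
  cases l with
  | none =>
    simp only [mStep, Option.ite_none_right_eq_some] at hp hq
    have := hp.1
    have := hq.1
    omega
  | some l =>
    obtain ⟨⟨i, j⟩, hij, hi⟩ := l
    change mStep p (mLetter i j hij hi) = _ at hp
    change mStep q (mLetter i j hij hi) = _ at hq
    have hp' : p = i ∨ p = j := by
      by_contra hcon
      rw [not_or] at hcon
      rw [mStep_eq_none hcon.1 hcon.2] at hp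
      cases hp
    have hq' : q = i ∨ q = j := by
      by_contra hcon
      rw [not_or] at hcon
      rw [mStep_eq_none hcon.1 hcon.2] at hq
      cases hq
    have h1 : p = i := by
      rcases hp' with h | h <;> rcases hq' with h' | h' <;> subst h <;> subst h' <;>
        first | rfl | exact absurd hpq (lt_irrefl _) | exact absurd hpq (lt_asymm hij)
    have h2 : q = j := by
      rcases hq' with h | h
      · exact absurd hpq (by rw [h, h1]; exact lt_irrefl _)
      · exact h
    subst h1 h2
    by_cases hj : q.val + 1 < n
    · rw [mStep_left hj] at hp
      rw [mStep_right hj] at hq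
      cases hp
      cases hq
      exact ⟨Fin.lt_def.2 (by simp only; omega), by simp only; omega⟩
    · have hj : q.val + 1 = n := by omega
      rw [mStep_left_last hj] at hp
      rw [mStep_right_last hj] at hq
      cases hp
      cases hq
      exact ⟨Fin.lt_def.2 (by simp only; omega), by simp only [add_mul, one_mul]; omega⟩

theorem mAutomaton_run_pair {s : Fin n} {F : Set (Fin n)} {p q p' q' : Fin n}
    {w : List (MLetter n)} (hpq : p < q) (hp : (mAutomaton s F).run p w = some p')
    (hq : (mAutomaton s F).run q w = some q') :
    p' < q' ∧ p.val * n + q.val + w.length ≤ p'.val * n + q'.val := by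
  induction w generalizing p q with
  | nil => cases hp; cases hq; exact ⟨hpq, by simp⟩
  | cons a w ih =>
    obtain ⟨p1, hp1, hp⟩ := Option.bind_eq_some_iff.1 hp
    obtain ⟨q1, hq1, hq⟩ := Option.bind_eq_some_iff.1 hq
    obtain ⟨h1, h2⟩ := mStep_pair hpq hp1 hq1
    obtain ⟨h3, h4⟩ := ih h1 hp hq
    exact ⟨h3, by simp only [List.length_cons]; omega⟩

/-- A surviving pair of distinct states keeps its order and strictly increases `p * n + q`, so it
never recurs; a word of this length would need more pairs than there are. -/
theorem mAutomaton_rank_le_one {s : Fin n} {F : Set (Fin n)} {p q p' q' : Fin n}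
    {w : List (MLetter n)} (hw : n.choose 2 ≤ w.length)
    (hp : (mAutomaton s F).run p w = some p') (hq : (mAutomaton s F).run q w = some q') :
    p' = q' := by
  have main : ∀ {p q p' q' : Fin n}, p < q → (mAutomaton s F).run p w = some p' →
      (mAutomaton s F).run q w = some q' → False := by
    intro p q p' q' hpq hp hq
    have hsplit : ∀ {p p' : Fin n} {i}, (mAutomaton s F).run p w = some p' →
        ∃ r, (mAutomaton s F).run p (w.take i) = some r ∧
          (mAutomaton s F).run r (w.drop i) = some p' := by
      intro p p' i h
      rw [← List.take_append_drop i w, PartialDFA.run_append] at h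
      exact Option.bind_eq_some_iff.1 h
    obtain ⟨i, j, hij, hj, h⟩ := exists_pair_repeat
      (fun i => (mAutomaton s F).run p (w.take i)) (fun i => (mAutomaton s F).run q (w.take i))
      w.length (by simpa using hw)
      (fun i _ => by obtain ⟨r, hr, -⟩ := hsplit (i := i) hp; simp [hr])
      (fun i _ => by obtain ⟨r, hr, -⟩ := hsplit (i := i) hq; simp [hr])
      (fun i _ => by
        obtain ⟨r, hr, -⟩ := hsplit (i := i) hp
        obtain ⟨r', hr', -⟩ := hsplit (i := i) hq
        have := (mAutomaton_run_pair hpq hr hr').1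
        simpa [hr, hr'] using this.ne)
    obtain ⟨p1, hp1, -⟩ := hsplit (i := i) hp
    obtain ⟨q1, hq1, -⟩ := hsplit (i := i) hq
    obtain ⟨p2, hp2, -⟩ := hsplit (i := j) hp
    obtain ⟨q2, hq2, -⟩ := hsplit (i := j) hq
    have h1 := (mAutomaton_run_pair hpq hp1 hq1).1
    have h2 := (mAutomaton_run_pair hpq hp2 hq2).1
    have htake : w.take j = w.take i ++ (w.drop i).take (j - i) := by
      rw [← List.take_add, Nat.add_sub_cancel' hij.le]
    have hp3 := hp2
    have hq3 := hq2
    rw [htake, PartialDFA.run_append, hp1] at hp3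
    rw [htake, PartialDFA.run_append, hq1] at hq3
    have h3 := (mAutomaton_run_pair h1 hp3 hq3).2
    have hlen : ((w.drop i).take (j - i)).length = j - i := by
      simp
      omega
    rw [hlen] at h3
    simp only [hp1, hp2, hq1, hq2, Option.some.injEq] at h
    rcases h with ⟨rfl, rfl⟩ | ⟨rfl, rfl⟩
    · omega
    · exact lt_asymm h1 h2
  rcases lt_trichotomy p q with h | rfl | h
  · exact (main h hp hq).elim
  · exact Option.some.inj (hp.symm.trans hq)
  · exact (main h hq hp).elim

/-- Every state leads to its successor, and the last state returns to `0` through `2`, by means of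
`b 0 (n - 1)` and the letter `a`. -/
theorem mAutomaton_connected (hn : 2 < n) (s : Fin n) (F : Set (Fin n)) (p q : Fin n) :
    ∃ w, (mAutomaton s F).run p w = some q := by
  have hone : ∀ {p q : Fin n} {l : MLetter n}, mStep p l = some q →
      ∃ w, (mAutomaton s F).run p w = some q := by
    intro p q l h
    exact ⟨[l], by simp [PartialDFA.run, mAutomaton, h]⟩
  have htrans : ∀ {p q r : Fin n}, (∃ w, (mAutomaton s F).run p w = some q) →
      (∃ w, (mAutomaton s F).run q w = some r) → ∃ w, (mAutomaton s F).run p w = some r := by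
    rintro p q r ⟨w, hw⟩ ⟨w', hw'⟩
    exact ⟨w ++ w', by rw [PartialDFA.run_append, hw]; exact hw'⟩
  have hsucc : ∀ (i : ℕ) (hi : i + 1 < n),
      ∃ w, (mAutomaton s F).run ⟨i, by omega⟩ w = some ⟨i + 1, hi⟩ := by
    intro i hi
    by_cases h : i + 2 < n
    · exact hone (mStep_left_last (i := ⟨i, by omega⟩) (j := ⟨n - 1, by omega⟩)
        (hij := Fin.lt_def.2 (by simp only; omega)) (hi := h) (by simp only; omega))
    · exact hone (mStep_right (i := ⟨0, by omega⟩) (j := ⟨i, by omega⟩)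
        (hij := Fin.lt_def.2 (by simp only; omega)) (hi := by simp only; omega) (by simpa using hi))
  have hup : ∀ (d i : ℕ) (hi : i + d < n),
      ∃ w, (mAutomaton s F).run ⟨i, by omega⟩ w = some ⟨i + d, hi⟩ := by
    intro d
    induction d with
    | zero => exact fun i hi => ⟨[], rfl⟩
    | succ d ih => exact fun i hi => htrans (ih i (by omega)) (hsucc (i + d) hi)
  have hlast : ∃ w, (mAutomaton s F).run ⟨n - 1, by omega⟩ w = some ⟨0, by omega⟩ := by
    refine htrans (q := ⟨2, hn⟩) ?_ ?_
    · exact hone (mStep_right_last (i := ⟨0, by omega⟩) (j := ⟨n - 1, by omega⟩)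
        (hij := Fin.lt_def.2 (by simp only; omega)) (hi := by simpa using hn) (by simp only; omega))
    · exact hone (l := none) (by simp [mStep])
  have h1 := hup (n - 1 - p.val) p.val (by omega)
  have h2 := hup q.val 0 (by omega)
  simp only [show p.val + (n - 1 - p.val) = n - 1 by omega] at h1
  simp only [Nat.zero_add] at h2
  exact htrans h1 (htrans hlast h2)

theorem exists_separating_letter (hn : 2 < n) {p q : Fin n} (hpq : p < q) :
    ∃ l : MLetter n, mStep p l = none ∧ mStep q l ≠ none ∨ mStep p l ≠ none ∧ mStep q l = none := by
  by_cases hp0 : p.val = 0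
  · have hp : p = ⟨0, by omega⟩ := Fin.ext hp0
    by_cases hq1 : q.val = 1
    · refine ⟨mLetter ⟨0, by omega⟩ ⟨2, hn⟩ (Fin.lt_def.2 (by simp)) (by simpa using hn),
        Or.inr ⟨mStep_ne_none (Or.inl hp), mStep_eq_none ?_ ?_⟩⟩ <;>
        simp only [ne_eq, Fin.ext_iff] <;> omega
    · refine ⟨mLetter ⟨0, by omega⟩ ⟨1, by omega⟩ (Fin.lt_def.2 (by simp)) (by simpa using hn),
        Or.inr ⟨mStep_ne_none (Or.inl hp), mStep_eq_none ?_ ?_⟩⟩ <;>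
        simp only [ne_eq, Fin.ext_iff] <;> omega
  · refine ⟨mLetter ⟨0, by omega⟩ q (Fin.lt_def.2 (by simp only; omega)) (by simpa using hn),
      Or.inl ⟨mStep_eq_none ?_ hpq.ne, mStep_ne_none (Or.inr rfl)⟩⟩
    simpa only [ne_eq, Fin.ext_iff] using hp0

theorem mAutomaton_isReduced (hn : 2 < n) (s : Fin n) {F : Set (Fin n)} (hF : F.Nonempty) :
    (mAutomaton s F).IsReduced := by
  refine ⟨mAutomaton_connected hn s F s, ?_⟩
  obtain ⟨f, hf⟩ := hF
  have hsep : ∀ {p q : Fin n} {l : MLetter n}, mStep p l = none → mStep q l ≠ none →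
      (mAutomaton s F).acceptsFrom p ≠ (mAutomaton s F).acceptsFrom q := by
    intro p q l hp hq heq
    obtain ⟨r, hr⟩ := Option.ne_none_iff_exists'.1 hq
    obtain ⟨w, hw⟩ := mAutomaton_connected hn s F r f
    have h1 : l :: w ∈ (mAutomaton s F).acceptsFrom q :=
      ⟨f, hf, by simp only [PartialDFA.run]; change (mStep q l).bind _ = _; rw [hr]; exact hw⟩
    rw [← heq] at h1
    obtain ⟨r', -, hr'⟩ := h1
    simp only [PartialDFA.run] at hr'
    change (mStep p l).bind _ = _ at hr'
    rw [hp] at hr'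
    cases hr'
  intro p q heq
  rcases lt_trichotomy p q with h | h | h
  · obtain ⟨l, ⟨h1, h2⟩ | ⟨h1, h2⟩⟩ := exists_separating_letter hn h
    · exact absurd heq (hsep h1 h2)
    · exact absurd heq.symm (hsep h2 h1)
  · exact h
  · obtain ⟨l, ⟨h1, h2⟩ | ⟨h1, h2⟩⟩ := exists_separating_letter hn h
    · exact absurd heq.symm (hsep h1 h2)
    · exact absurd heq (hsep h2 h1)

/-- A word that runs through all pairs of states. -/
theorem exists_long_pair_word (s : Fin n) (F : Set (Fin n)) (i : ℕ) (hi : i + 2 ≤ n) :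
    ∃ w, w.length + (n - i).choose 2 = n.choose 2 ∧
      (mAutomaton s F).run ⟨0, by omega⟩ w = some ⟨i, by omega⟩ ∧
      (mAutomaton s F).run ⟨1, by omega⟩ w = some ⟨i + 1, by omega⟩ := by
  induction i with
  | zero => exact ⟨[], by simp, rfl, rfl⟩
  | succ i ih =>
    obtain ⟨w, hw, h0, h1⟩ := ih (by omega)
    -- Within a row the first state `i` is fixed and the second advances by one with each letter;
    -- one further letter passes from `(i, n - 1)` to `(i + 1, i + 2)`.
    have hrow : ∀ (d : ℕ) (hd : i + 1 + d < n), ∃ w : List (MLetter n), w.length = d ∧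
        (mAutomaton s F).run ⟨i, by omega⟩ w = some ⟨i, by omega⟩ ∧
        (mAutomaton s F).run ⟨i + 1, by omega⟩ w = some ⟨i + 1 + d, hd⟩ := by
      intro d
      induction d with
      | zero => exact fun hd => ⟨[], rfl, rfl, rfl⟩
      | succ d ihd =>
        intro hd
        obtain ⟨w, hw, h0, h1⟩ := ihd (by omega)
        have hlt : (⟨i, by omega⟩ : Fin n) < ⟨i + 1 + d, by omega⟩ :=
          Fin.lt_def.2 (by simp only; omega)
        obtain ⟨l, h2, h3⟩ : ∃ l : MLetter n, mStep ⟨i, by omega⟩ l = some ⟨i, by omega⟩ ∧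
            mStep ⟨i + 1 + d, by omega⟩ l = some ⟨i + 1 + (d + 1), hd⟩ :=
          ⟨mLetter _ _ hlt (by simp only; omega), mStep_left hd, mStep_right hd⟩
        refine ⟨w ++ [l], by simp [hw], ?_, ?_⟩
        · rw [PartialDFA.run_append, h0]
          change (mStep _ _).bind some = _
          rw [h2]
          rfl
        · rw [PartialDFA.run_append, h1]
          change (mStep _ _).bind some = _
          rw [h3]
          rfl
    obtain ⟨w', hw', h0', h1'⟩ := hrow (n - 2 - i) (by omega)
    have hj : i + 1 + (n - 2 - i) + 1 = n := by omega
    have hlt : (⟨i, by omega⟩ : Fin n) < ⟨i + 1 + (n - 2 - i), by omega⟩ :=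
      Fin.lt_def.2 (by simp only; omega)
    obtain ⟨l, h2, h3⟩ : ∃ l : MLetter n, mStep ⟨i, by omega⟩ l = some ⟨i + 1, by omega⟩ ∧
        mStep ⟨i + 1 + (n - 2 - i), by omega⟩ l = some ⟨i + 1 + 1, by omega⟩ :=
      ⟨mLetter _ _ hlt (by simp only; omega), mStep_left_last hj, mStep_right_last hj⟩
    refine ⟨w ++ (w' ++ [l]), ?_, ?_, ?_⟩
    rotate_left
    · rw [PartialDFA.run_append, h0, Option.bind_some, PartialDFA.run_append, h0']
      change (mStep _ _).bind some = _
      rw [h2]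
      rfl
    · rw [PartialDFA.run_append, h1, Option.bind_some, PartialDFA.run_append, h1']
      change (mStep _ _).bind some = _
      rw [h3]
      rfl
    · have h4 : n - i = (n - (i + 1)) + 1 := by omega
      have h5 : (n - i).choose 2 = n - (i + 1) + (n - (i + 1)).choose 2 := by
        rw [h4, Nat.choose_succ_succ' _ 1, Nat.choose_one_right]
      simp only [List.length_append, List.length_cons, List.length_nil]
      omega

theorem mAutomaton_lt_of_isKTestable (hn : 2 < n) (s : Fin n) {F : Set (Fin n)} (hF : F.Nonempty)
    {k : ℕ} (hk : IsKTestable (mAutomaton s F).accepts k) : n.choose 2 < k := by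
  by_contra hcon
  -- This `w` has length `n.choose 2 - 1` and leads `0` to `n - 2` and `1` to `n - 1`.
  obtain ⟨w, hw, h0, h1⟩ := exists_long_pair_word s F (n - 2) (by omega)
  rw [show n - (n - 2) = 2 by omega, Nat.choose_self] at hw
  obtain ⟨f, hf⟩ := hF
  obtain ⟨u, hu⟩ := mAutomaton_connected hn s F s ⟨0, by omega⟩
  obtain ⟨z, hz⟩ := mAutomaton_connected hn s F ⟨n - 2 + 1, by omega⟩ f
  obtain ⟨g, hg⟩ := mAutomaton_connected hn s F ⟨n - 2 + 1, by omega⟩ ⟨1, by omega⟩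
  -- The letter `l` is defined at `n - 2` but not at `n - 1`. Hence `l g` can be read after the
  -- first `w`, from `n - 2`, but not after the second, which ends at `n - 1`: doubling the block
  -- destroys acceptance.
  let l : MLetter n := mLetter ⟨0, by omega⟩ ⟨n - 2, by omega⟩
    (Fin.lt_def.2 (by simp only; omega)) (by simpa using hn)
  have hl1 : (mAutomaton s F).run ⟨n - 2, by omega⟩ (l :: g) = some ⟨1, by omega⟩ := by
    have : mStep ⟨n - 2, by omega⟩ l = some ⟨n - 2 + 1, by omega⟩ :=
      mStep_right (by simp only; omega)
    change (mStep _ l).bind _ = _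
    rw [this]
    exact hg
  have hl2 : (mAutomaton s F).run ⟨n - 2 + 1, by omega⟩ (l :: g) = none := by
    have : mStep ⟨n - 2 + 1, by omega⟩ l = none :=
      mStep_eq_none (by simp) (by simp)
    change (mStep _ l).bind _ = _
    rw [this]
    rfl
  have hdata := sameLocalData_double (k := k) (e := w) (by omega) u (l :: g) z
  have hiff := hk.2 _ _ (by simp) (by simp) hdata
  have hmem : u ++ (w ++ (l :: g ++ (w ++ z))) ∈ (mAutomaton s F).accepts := by
    refine ⟨f, hf, ?_⟩
    change (mAutomaton s F).run s _ = _
    simp only [PartialDFA.run_append, hu, h0, hl1, h1, hz, Option.bind_some]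
  obtain ⟨r, -, hr⟩ := hiff.2 hmem
  change (mAutomaton s F).run s _ = _ at hr
  simp only [PartialDFA.run_append, hu, h0, hl1, h1, hl2, Option.bind_some, Option.bind_none] at hr
  cases hr

theorem mAutomaton_isKTestable (s : Fin n) (F : Set (Fin n)) :
    IsKTestable (mAutomaton s F).accepts (n.choose 2 + 1) :=
  (mAutomaton s F).isKTestable_of_rank_le_one fun _ _ _ _ _ hw hp hq =>
    mAutomaton_rank_le_one hw.ge hp hq

theorem mAutomaton_order (hn : 2 < n) (s : Fin n) {F : Set (Fin n)} (hF : F.Nonempty) :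
    (mAutomaton s F).order = n.choose 2 + 1 :=
  PartialDFA.order_eq (mAutomaton_isKTestable s F) fun _ hk =>
    mAutomaton_lt_of_isKTestable hn s hF hk

end AutomatonM

/-! ### Extremal automata with one and two states -/

section SmallAutomata

/-- An automaton with one state. -/
def oneStateAutomaton : PartialDFA Empty Unit where
  step _ _ := none
  start := ()
  accept := Set.univ

theorem oneStateAutomaton_isReduced : oneStateAutomaton.IsReduced :=
  ⟨fun _ => ⟨[], rfl⟩, fun _ _ _ => rfl⟩

theorem oneStateAutomaton_isKTestable : IsKTestable oneStateAutomaton.accepts 1 := by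
  refine ⟨le_rfl, fun u _ hu => ?_⟩
  cases u with
  | nil => exact absurd rfl hu
  | cons a _ => exact a.elim

theorem oneStateAutomaton_order : oneStateAutomaton.order = 1 :=
  PartialDFA.order_eq (m := 0) oneStateAutomaton_isKTestable fun _ hk => hk.1

/-- An automaton that accepts the words that begin with the letter `true`. -/
def firstLetterAutomaton : PartialDFA Bool (Fin 2) where
  step p a := if p = 1 ∨ a = true then some 1 else none
  start := 0
  accept := {1}

theorem firstLetterAutomaton_run_one (w : List Bool) : firstLetterAutomaton.run 1 w = some 1 := by
  induction w with
  | nil => rfl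
  | cons a w ih => simpa [PartialDFA.run, firstLetterAutomaton] using ih

theorem firstLetterAutomaton_run_cons (p : Fin 2) (a : Bool) (w : List Bool) :
    firstLetterAutomaton.run p (a :: w) = if p = 1 ∨ a = true then some 1 else none := by
  change (if p = 1 ∨ a = true then some (1 : Fin 2) else none).bind _ = _
  split_ifs
  · exact firstLetterAutomaton_run_one w
  · rfl

theorem cons_mem_firstLetterAutomaton (a : Bool) (w : List Bool) :
    a :: w ∈ firstLetterAutomaton.accepts ↔ a = true := by
  change (∃ q ∈ ({1} : Set (Fin 2)), firstLetterAutomaton.run 0 (a :: w) = some q) ↔ _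
  rw [firstLetterAutomaton_run_cons]
  cases a <;> simp

theorem firstLetterAutomaton_leftZero : firstLetterAutomaton.HasLeftZeroTransitionSemigroup := by
  intro x y hx _ p
  cases x with
  | nil => exact absurd rfl hx
  | cons a x => rw [List.cons_append, firstLetterAutomaton_run_cons, firstLetterAutomaton_run_cons]

theorem firstLetterAutomaton_isReduced : firstLetterAutomaton.IsReduced := by
  have h0 : [] ∉ firstLetterAutomaton.acceptsFrom 0 := by
    rintro ⟨q, hq, h⟩
    cases Set.mem_singleton_iff.1 hq
    cases h
  have h1 : [] ∈ firstLetterAutomaton.acceptsFrom 1 := ⟨1, rfl, rfl⟩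
  constructor
  · intro p
    fin_cases p
    · exact ⟨[], rfl⟩
    · exact ⟨[true], rfl⟩
  · intro p q h
    fin_cases p <;> fin_cases q
    · rfl
    · exact absurd (h ▸ h1) h0
    · exact absurd (h ▸ h1) h0
    · rfl

theorem firstLetterAutomaton_isKTestable : IsKTestable firstLetterAutomaton.accepts 2 := by
  refine ⟨by norm_num, fun u v hu hv huv => ?_⟩
  cases u with
  | nil => exact absurd rfl hu
  | cons a u =>
    cases v with
    | nil => exact absurd rfl hv
    | cons b v =>
      have h := huv.1
      simp at h
      rw [cons_mem_firstLetterAutomaton, cons_mem_firstLetterAutomaton, h]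

theorem firstLetterAutomaton_order : firstLetterAutomaton.order = 2 := by
  refine PartialDFA.order_eq firstLetterAutomaton_isKTestable fun k hk => ?_
  by_contra hcon
  obtain rfl : k = 1 := le_antisymm (not_lt.1 hcon) hk.1
  have hfac : ∀ a b : Bool, {f : List Bool | f <:+: [a, b] ∧ f.length = 1} = {[a], [b]} := by
    intro a b
    ext f
    constructor
    · rintro ⟨hf, h⟩
      obtain ⟨c, rfl⟩ := List.length_eq_one_iff.1 h
      have := hf.subset (a := c) (by simp)
      simpa using this
    · rintro (rfl | rfl)
      · exact ⟨⟨[], [b], rfl⟩, rfl⟩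
      · exact ⟨⟨[a], [], rfl⟩, rfl⟩
  -- For `k = 1` the prefixes and suffixes compared are empty, and both words have the same letters,
  -- but only one begins with `true`.
  have := hk.2 [true, false] [false, true] (by simp) (by simp)
    ⟨rfl, rfl, by rw [hfac, hfac, Set.pair_comm]⟩
  rw [cons_mem_firstLetterAutomaton, cons_mem_firstLetterAutomaton] at this
  simp at this

end SmallAutomata

theorem choose_two_eq (n : ℕ) : n.choose 2 = (n ^ 2 - n) / 2 := by
  rw [Nat.choose_two_right, Nat.mul_sub, mul_one, sq]

end LocalTestability

theorem mainTheorem2 (n : ℕ) (hn : 1 ≤ n) :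
    -- upper bound
    (∀ (α : Type u) (σ : Type v) [Finite α] [Finite σ] (A : LocalTestability.PartialDFA α σ),
      Nat.card σ = n → A.IsReduced → A.IsLocallyTestable → A.order ≤ (n ^ 2 - n) / 2 + 1) ∧
    -- the bound is attained
    (∃ (α : Type) (σ : Type) (_ : Finite α) (_ : Finite σ) (A : LocalTestability.PartialDFA α σ),
      Nat.card σ = n ∧ A.IsReduced ∧ A.IsLocallyTestable ∧ A.order = (n ^ 2 - n) / 2 + 1) ∧
    -- for `n > 2` it is attained by the automaton `M`
    (2 < n → ∀ (s : Fin n) (F : Set (Fin n)), F.Nonempty →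
      (LocalTestability.mAutomaton s F).IsReduced ∧
      (LocalTestability.mAutomaton s F).IsLocallyTestable ∧
      (LocalTestability.mAutomaton s F).order = (n ^ 2 - n) / 2 + 1) ∧
    -- for `n = 2` it is attained with a semigroup of left zeros
    (n = 2 → ∃ (α : Type) (_ : Finite α) (A : LocalTestability.PartialDFA α (Fin n)),
      A.HasLeftZeroTransitionSemigroup ∧ A.IsReduced ∧ A.IsLocallyTestable ∧
      A.order = (n ^ 2 - n) / 2 + 1) := by
  rw [← LocalTestability.choose_two_eq]
  refine ⟨?_, ?_, ?_, ?_⟩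
  · rintro α σ _ _ A rfl hA ht
    exact hA.order_le ht
  · obtain h | h | h : n = 1 ∨ n = 2 ∨ 2 < n := by omega
    · subst h
      exact ⟨Empty, Unit, inferInstance, inferInstance, LocalTestability.oneStateAutomaton, by simp,
        LocalTestability.oneStateAutomaton_isReduced,
        ⟨_, LocalTestability.oneStateAutomaton_isKTestable⟩,
        LocalTestability.oneStateAutomaton_order⟩
    · subst h
      exact ⟨Bool, Fin 2, inferInstance, inferInstance, LocalTestability.firstLetterAutomaton,
        by simp, LocalTestability.firstLetterAutomaton_isReduced,
        ⟨_, LocalTestability.firstLetterAutomaton_isKTestable⟩,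
        LocalTestability.firstLetterAutomaton_order⟩
    · exact ⟨LocalTestability.MLetter n, Fin n, inferInstance, inferInstance,
        LocalTestability.mAutomaton ⟨0, hn⟩ Set.univ, by simp,
        LocalTestability.mAutomaton_isReduced h _ ⟨⟨0, hn⟩, trivial⟩,
        ⟨_, LocalTestability.mAutomaton_isKTestable _ _⟩,
        LocalTestability.mAutomaton_order h _ ⟨⟨0, hn⟩, trivial⟩⟩
  · intro h s F hF
    exact ⟨LocalTestability.mAutomaton_isReduced h s hF,
      ⟨_, LocalTestability.mAutomaton_isKTestable s F⟩, LocalTestability.mAutomaton_order h s hF⟩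
  · rintro rfl
    exact ⟨Bool, inferInstance, LocalTestability.firstLetterAutomaton,
      LocalTestability.firstLetterAutomaton_leftZero,
      LocalTestability.firstLetterAutomaton_isReduced,
      ⟨_, LocalTestability.firstLetterAutomaton_isKTestable⟩,
      LocalTestability.firstLetterAutomaton_order⟩
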